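/- Let $G$ be an $m\times p$ matrix of real rational functions ($m$ outputs, $p$ inputs) that is strictly proper and stable (every entry has numerator degree smaller than denominator degree, and all its poles lie in the open left half-plane). Let $n$ be the McMillan degree of $G$, i.e. the smallest $N$ for which there are real matrices $A\in\mathbb R^{N\times N}$, $B\in\mathbb R^{N\times p}$, $C\in\mathbb R^{m\times N}$ with $G(s)=C(sI-A)^{-1}B$, and let $(A,B,C)$ be any such realization of order $N=n$. Put $g(t)=Ce^{tA}B$ and $(g*u)(t)=\int_0^t g(t-s)u(s)\,ds$ for $t\ge 0$, and let $$\|G\|_{\rm pk\_gn}=\sup_{0\neq u\in L^\infty([0,\infty),\mathbb R^p)}\frac{\|g*u\|_{\infty,\infty}}{\|u\|_{\infty,\infty}},\qquad \|u\|_{\infty,\infty}=\operatorname*{ess\,sup}_{t\ge 0}\max_k|u_k(t)|,$$ be the peak-gain norm. Let $\sigma_{H1},\dots,\sigma_{Hn}$ be the Hankel singular values of $G$, i.e. the square roots of the eigenvalues, counted with multiplicity, of $W_cW_o$, where $$W_c=\int_0^\infty e^{tA}BB^Te^{tA^T}\,dt,\qquad W_o=\int_0^\infty e^{tA^T}C^TCe^{tA}\,dt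 .$$ Then $$\|G\|_{\rm pk\_gn}\le 2p^{1/2}\left(\sigma_{H1}+\dots+\sigma_{Hn}\right).$$ In particular, $$\|G\|_{\rm pk\_gn}\le 2n\,p^{1/2}\,\|G\|_\infty,\qquad \|G\|_\infty=\sup_{\omega\in\mathbb R}\overline\sigma\big(G(i\omega)\big),$$ where $\overline\sigma$ denotes the largest singular value. -/

import Mathlib

open MeasureTheory Polynomial
open scoped ENNReal

/-- Every entry of the real-rational matrix `G` has numerator degree smaller than its denominator
degree. -/
def IsStrictlyProper {m p : ℕ} (G : Matrix (Fin m) (Fin p) (RatFunc ℝ)) : Prop :=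
  ∀ i j, (G i j).num.degree < (G i j).denom.degree

/-- All complex poles of the entries of `G` lie in the open left half-plane. -/
def IsStable {m p : ℕ} (G : Matrix (Fin m) (Fin p) (RatFunc ℝ)) : Prop :=
  ∀ i j, ∀ s : ℂ, aeval s (G i j).denom = 0 → s.re < 0

/-- `(A, B, C)` is a state-space realization of order `N` of `G`: `G(s) = C (s I - A)⁻¹ B`,
as an identity of matrices of rational functions. -/
def IsRealization {m p N : ℕ} (G : Matrix (Fin m) (Fin p) (RatFunc ℝ))
    (A : Matrix (Fin N) (Fin N) ℝ) (B : Matrix (Fin N) (Fin p) ℝ)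
    (C : Matrix (Fin m) (Fin N) ℝ) : Prop :=
  G = C.map RatFunc.C * (Matrix.scalar (Fin N) RatFunc.X - A.map RatFunc.C)⁻¹ * B.map RatFunc.C

/-- The McMillan degree of `G`: the smallest order of a state-space realization of `G`.
For strictly proper `G` a realization exists, see `exists_minimal_realization`. -/
noncomputable def mcMillanDegree {m p : ℕ} (G : Matrix (Fin m) (Fin p) (RatFunc ℝ)) : ℕ :=
  sInf {N : ℕ | ∃ (A : Matrix (Fin N) (Fin N) ℝ) (B : Matrix (Fin N) (Fin p) ℝ)
    (C : Matrix (Fin m) (Fin N) ℝ), IsRealization G A B C}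

theorem common_denominator {m p : ℕ} (G : Matrix (Fin m) (Fin p) (RatFunc ℝ))
    (hG : IsStrictlyProper G) :
    ∃ D : ℝ[X], D.Monic ∧ ∀ i j, ∃ q : ℝ[X], q.degree < D.degree ∧
      G i j = algebraMap ℝ[X] (RatFunc ℝ) q / algebraMap ℝ[X] (RatFunc ℝ) D := by
  refine ⟨∏ x : Fin m × Fin p, (G x.1 x.2).denom,
    monic_prod_of_monic _ _ fun x _ => RatFunc.monic_denom _, fun i j => ?_⟩
  have hprod := Finset.mul_prod_erase (Finset.univ : Finset (Fin m × Fin p))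
    (fun x => (G x.1 x.2).denom) (Finset.mem_univ (i, j))
  set R := ∏ x ∈ (Finset.univ : Finset (Fin m × Fin p)).erase (i, j), (G x.1 x.2).denom with hR
  have hRm : R.Monic := monic_prod_of_monic _ _ fun x _ => RatFunc.monic_denom _
  rw [← hprod]
  refine ⟨(G i j).num * R, ?_, ?_⟩
  · rw [degree_mul, degree_mul]
    have h0 : R.degree ≠ ⊥ := by simpa using hRm.ne_zero
    exact WithBot.add_lt_add_right h0 (hG i j)
  · have h1 : algebraMap ℝ[X] (RatFunc ℝ) R ≠ 0 := by simpa using hRm.ne_zero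
    simp only [map_mul]
    rw [mul_div_mul_right _ _ h1, RatFunc.num_div_denom]

theorem exists_realization {m p : ℕ} (G : Matrix (Fin m) (Fin p) (RatFunc ℝ))
    (hG : IsStrictlyProper G) :
    ∃ (N : ℕ) (A : Matrix (Fin N) (Fin N) ℝ) (B : Matrix (Fin N) (Fin p) ℝ)
      (C : Matrix (Fin m) (Fin N) ℝ), IsRealization G A B C := by
  obtain ⟨D, hD, hq⟩ := common_denominator G hG
  choose q hqd hqe using hq
  set d := D.natDegree with hd
  let e : Fin m × Fin d ≃ Fin (m * d) := finProdFinEquiv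
  let A0 : Matrix (Fin m × Fin d) (Fin m × Fin d) ℝ := fun a b =>
    if a.1 = b.1 then
      (if (b.2 : ℕ) + 1 = d then - D.coeff a.2 else if (a.2 : ℕ) = b.2 + 1 then 1 else 0)
    else 0
  let B0 : Matrix (Fin m × Fin d) (Fin p) ℝ := fun a j => (q a.1 j).coeff a.2
  let C0 : Matrix (Fin m) (Fin m × Fin d) ℝ := fun i b =>
    if i = b.1 ∧ (b.2 : ℕ) + 1 = d then 1 else 0
  let V : Matrix (Fin m) (Fin m × Fin d) (RatFunc ℝ) := fun i b =>
    if i = b.1 then RatFunc.X ^ (b.2 : ℕ) / algebraMap ℝ[X] (RatFunc ℝ) D else 0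
  have hD0 : algebraMap ℝ[X] (RatFunc ℝ) D ≠ 0 := by simpa using hD.ne_zero
  have hDsum : algebraMap ℝ[X] (RatFunc ℝ) D
      = RatFunc.X ^ d + ∑ k : Fin d, RatFunc.C (D.coeff k) * RatFunc.X ^ (k : ℕ) := by
    conv_lhs => rw [hD.as_sum]
    simp [Finset.sum_range, ← hd]
  have hVC : V * (Matrix.scalar (Fin m × Fin d) RatFunc.X - A0.map RatFunc.C)
      = C0.map RatFunc.C := by
    have hXV : V * Matrix.scalar (Fin m × Fin d) (RatFunc.X : RatFunc ℝ)
        = (RatFunc.X : RatFunc ℝ) • V := by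
      ext i b; simp [Matrix.scalar_apply, Matrix.mul_diagonal, mul_comm]
    rw [Matrix.mul_sub, hXV]
    have eV : ∀ i b, V i b = if i = b.1 then
      RatFunc.X ^ (b.2 : ℕ) / algebraMap ℝ[X] (RatFunc ℝ) D else 0 := fun _ _ => rfl
    have eA : ∀ a b, (A0.map RatFunc.C) a b = RatFunc.C (if a.1 = b.1 then
      (if (b.2 : ℕ) + 1 = d then - D.coeff a.2 else if (a.2 : ℕ) = b.2 + 1 then 1 else 0)
      else 0) := fun _ _ => rfl
    have eC : ∀ i b, (C0.map RatFunc.C) i b =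
      RatFunc.C (if i = b.1 ∧ (b.2 : ℕ) + 1 = d then 1 else 0) := fun _ _ => rfl
    ext i ⟨i', k⟩
    have hsum : (V * A0.map RatFunc.C) i (i', k) = if i = i' then ∑ l : Fin d,
        RatFunc.X ^ (l : ℕ) / algebraMap ℝ[X] (RatFunc ℝ) D *
          RatFunc.C (if (k : ℕ) + 1 = d then - D.coeff l else if (l : ℕ) = k + 1 then 1 else 0)
        else 0 := by
      rw [Matrix.mul_apply, Fintype.sum_prod_type, Finset.sum_eq_single i]
      · simp only [eV, eA]
        by_cases h : i = i' <;> simp [h]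
      · intro c _ hc; simp [eV, Ne.symm hc]
      · simp
    rw [Matrix.sub_apply, hsum, Matrix.smul_apply, eV, eC, smul_eq_mul]
    by_cases h : i = i'
    · subst h
      by_cases hk : (k : ℕ) + 1 = d
      · simp only [if_true, hk, and_self, map_one, map_neg]
        have : ∑ l : Fin d, RatFunc.X ^ (l : ℕ) / algebraMap ℝ[X] (RatFunc ℝ) D
              * -RatFunc.C (D.coeff l)
            = - (∑ l : Fin d, RatFunc.C (D.coeff l) * RatFunc.X ^ (l : ℕ))
              / algebraMap ℝ[X] (RatFunc ℝ) D := by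
          rw [← Finset.sum_neg_distrib, Finset.sum_div]
          refine Finset.sum_congr rfl fun l _ => by ring
        rw [this, ← mul_div_assoc, ← pow_succ', hk, ← sub_div, sub_neg_eq_add, ← hDsum,
          div_self hD0]
      · have hk' : (k : ℕ) + 1 < d := lt_of_le_of_ne k.2 hk
        simp only [if_true, hk, if_false, and_false, map_zero]
        rw [Finset.sum_eq_single (⟨k + 1, hk'⟩ : Fin d)]
        · simp only [if_true, map_one, pow_succ']
          ring
        · intro l _ hl
          have : (l : ℕ) ≠ k + 1 := fun h => hl (Fin.ext h)
          simp [this]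
        · simp
    · simp [h]
  have hVB : V * B0.map RatFunc.C = G := by
    ext i j
    rw [Matrix.mul_apply, Fintype.sum_prod_type, Finset.sum_eq_single i]
    · have hqs : algebraMap ℝ[X] (RatFunc ℝ) (q i j)
          = ∑ k : Fin d, RatFunc.C ((q i j).coeff k) * RatFunc.X ^ (k : ℕ) := by
        by_cases hq0 : q i j = 0
        · simp [hq0]
        · have hlt : (q i j).natDegree < d := natDegree_lt_natDegree hq0 (hqd i j)
          conv_lhs => rw [(q i j).as_sum_range' d hlt]
          simp only [← C_mul_X_pow_eq_monomial, map_sum, map_mul, map_pow, RatFunc.algebraMap_C,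
            RatFunc.algebraMap_X, Finset.sum_range]
      rw [hqe i j, hqs, Finset.sum_div]
      refine Finset.sum_congr rfl fun k _ => ?_
      have hb : B0.map RatFunc.C (i, k) j = RatFunc.C ((q i j).coeff k) := rfl
      rw [hb]
      simp only [V, if_true]
      ring
    · intro c _ hc; simp [V, Ne.symm hc]
    · simp
  have hdet : IsUnit (Matrix.scalar (Fin m × Fin d) RatFunc.X - A0.map RatFunc.C).det := by
    have h1 : (Matrix.scalar (Fin m × Fin d) RatFunc.X - A0.map RatFunc.C)
        = (algebraMap ℝ[X] (RatFunc ℝ)).mapMatrix A0.charmatrix := by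
      ext a b
      by_cases hab : a = b <;> simp [hab]
    rw [h1, ← RingHom.map_det, isUnit_iff_ne_zero]
    exact (map_ne_zero_iff _ (RatFunc.algebraMap_injective ℝ)).2 (Matrix.charpoly_monic A0).ne_zero
  have hG0 : C0.map RatFunc.C * (Matrix.scalar (Fin m × Fin d) RatFunc.X - A0.map RatFunc.C)⁻¹
      * B0.map RatFunc.C = G := by
    rw [← hVC, Matrix.mul_nonsing_inv_cancel_right _ _ hdet, hVB]
  refine ⟨m * d, A0.submatrix e.symm e.symm, B0.submatrix e.symm id, C0.submatrix id e.symm, ?_⟩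
  have hs : (Matrix.scalar (Fin (m * d)) RatFunc.X - (A0.submatrix e.symm e.symm).map RatFunc.C)
      = (Matrix.scalar (Fin m × Fin d) RatFunc.X - A0.map RatFunc.C).submatrix e.symm e.symm := by
    ext a b
    by_cases hab : a = b <;> simp [hab]
  unfold IsRealization
  rw [hs, Matrix.inv_submatrix_equiv, ← Matrix.submatrix_map, ← Matrix.submatrix_map,
    Matrix.submatrix_mul_equiv, Matrix.submatrix_mul_equiv, hG0, Matrix.submatrix_id_id]

theorem exists_minimal_realization {m p : ℕ} (G : Matrix (Fin m) (Fin p) (RatFunc ℝ))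
    (hG : IsStrictlyProper G) :
    ∃ (A : Matrix (Fin (mcMillanDegree G)) (Fin (mcMillanDegree G)) ℝ)
      (B : Matrix (Fin (mcMillanDegree G)) (Fin p) ℝ)
      (C : Matrix (Fin m) (Fin (mcMillanDegree G)) ℝ), IsRealization G A B C :=
  Nat.sInf_mem (exists_realization G hG)

/-- The impulse response `g(t) = C e^{tA} B` of the system `x' = A x + B u`, `y = C x`. -/
noncomputable def impulseResponse {m p N : ℕ} (A : Matrix (Fin N) (Fin N) ℝ)
    (B : Matrix (Fin N) (Fin p) ℝ) (C : Matrix (Fin m) (Fin N) ℝ) (t : ℝ) :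
    Matrix (Fin m) (Fin p) ℝ :=
  C * NormedSpace.exp (t • A) * B

/-- The response `(g ∗ u)(t) = ∫₀ᵗ g(t - s) u(s) ds`, for signals that vanish at negative times. -/
noncomputable def response {m p : ℕ} (g : ℝ → Matrix (Fin m) (Fin p) ℝ) (u : ℝ → Fin p → ℝ)
    (t : ℝ) : Fin m → ℝ :=
  fun i => ∫ s in (0 : ℝ)..t, (Matrix.mulVec (g (t - s)) (u s)) i

/-- The signal norm `‖u‖_{∞,∞}`: the essential supremum over `t ≥ 0` of `max_k |u_k(t)|`
(the norm of `Fin k → ℝ` is the maximum norm). -/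
noncomputable def peakNorm {k : ℕ} (u : ℝ → Fin k → ℝ) : ℝ≥0∞ :=
  eLpNorm u ⊤ (volume.restrict (Set.Ici (0 : ℝ)))

/-- The peak-to-peak (peak-gain) norm: the supremum of `‖g ∗ u‖_{∞,∞} / ‖u‖_{∞,∞}` over all
nonzero inputs `u ∈ L^∞([0,∞), ℝ^p)`. -/
noncomputable def peakGain {m p : ℕ} (g : ℝ → Matrix (Fin m) (Fin p) ℝ) : ℝ≥0∞ :=
  ⨆ (u : ℝ → Fin p → ℝ) (_ : MemLp u ⊤ (volume.restrict (Set.Ici (0 : ℝ))))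
    (_ : peakNorm u ≠ 0), peakNorm (response g u) / peakNorm u

/-- The controllability Gramian `∫₀^∞ e^{tA} B Bᵀ e^{tAᵀ} dt`, taken entrywise. -/
noncomputable def controllabilityGramian {p N : ℕ} (A : Matrix (Fin N) (Fin N) ℝ)
    (B : Matrix (Fin N) (Fin p) ℝ) : Matrix (Fin N) (Fin N) ℝ :=
  Matrix.of fun i j => ∫ t in Set.Ioi (0 : ℝ),
    (NormedSpace.exp (t • A) * B * B.transpose * NormedSpace.exp (t • A.transpose)) i j

/-- The observability Gramian `∫₀^∞ e^{tAᵀ} Cᵀ C e^{tA} dt`, taken entrywise. -/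
noncomputable def observabilityGramian {m N : ℕ} (A : Matrix (Fin N) (Fin N) ℝ)
    (C : Matrix (Fin m) (Fin N) ℝ) : Matrix (Fin N) (Fin N) ℝ :=
  Matrix.of fun i j => ∫ t in Set.Ioi (0 : ℝ),
    (NormedSpace.exp (t • A.transpose) * C.transpose * C * NormedSpace.exp (t • A)) i j

/-- The Hankel singular values `σ_{H1}, …, σ_{Hn}` of a stable system, computed from a minimal
realization: the square roots of the eigenvalues, with algebraic multiplicity, of `W_c W_o`. As a
product of two positive semidefinite matrices, `W_c W_o` has only real nonnegative eigenvalues, so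
this multiset has as many elements as the order of the realization. It is the same for all minimal
realizations, since they are related by state-space transformations. -/
noncomputable def hankelSingularValues {m p N : ℕ} (A : Matrix (Fin N) (Fin N) ℝ)
    (B : Matrix (Fin N) (Fin p) ℝ) (C : Matrix (Fin m) (Fin N) ℝ) : Multiset ℝ :=
  (controllabilityGramian A B * observabilityGramian A C).charpoly.roots.map Real.sqrt

/-- The value of `G` at a complex number `s` that is not a pole. -/
noncomputable def evalAt {m p : ℕ} (G : Matrix (Fin m) (Fin p) (RatFunc ℝ)) (s : ℂ) :
    Matrix (Fin m) (Fin p) ℂ :=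
  G.map (RatFunc.eval (algebraMap ℝ ℂ) s)

/-- The H-infinity norm of a stable `G`: the supremum over real frequencies `ω` of the largest
singular value (the Euclidean operator norm) of `G(iω)`. -/
noncomputable def hInfNorm {m p : ℕ} (G : Matrix (Fin m) (Fin p) (RatFunc ℝ)) : ℝ≥0∞ :=
  ⨆ ω : ℝ, ENNReal.ofReal
    ‖LinearMap.toContinuousLinearMap (Matrix.toEuclideanLin (evalAt G (ω * Complex.I)))‖

/-! The impulse response splits at half time: `g(t) = (C e^{tA/2} T) (S e^{tA/2} B)` whenever `T S =
1`. A weighted AM-GM inequality bounds each row sum of `|g(t)|` by `√p / 2` times the sum of the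
squared Frobenius norms of the two factors (`Matrix.row_sum_mul_le`). The integrals over `t > 0` of
these squared norms are twice the traces of `Tᵀ W_o T` and `S W_c Sᵀ`, the 2 coming from the half
time. A balancing transformation (`exists_balancing`) makes both traces equal to the sum of the
Hankel singular values, so the integral of the bound is `2 √p Σ σ`, which dominates the peak gain by
Young's inequality (`peakGain_le_of_row_sum_le`).

Two consequences of minimality are needed. The realization is controllable and observable, so both
Gramians are positive definite and can be balanced. It also has no hidden modes: the product of the
denominators of `G` annihilates `A`, so stability of `G` makes `e^{tA}` decay and the Gramians
converge.

For the second bound, each of the at most `n` Hankel singular values is at most `‖G‖_∞`. A past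
input steering the system to a state `W_c x` produces a whole-line output whose Fourier transform is
`G(iω)` times that of the input. Plancherel bounds the energy of the output, hence of its part on `t
> 0` (`IsHurwitz.hankel_energy_le`); choosing `x = W_o v` with `v` an eigenvector of `W_c W_o`
isolates one singular value. -/

/-! ### Algebra of the resolvent over the rational functions. -/

section ResolventAlgebra

variable {K : Type*} [Field K] {n l q : Type*} [Fintype n] [DecidableEq n]

theorem map_C_map_algebraMap (N : Matrix l q K) :
    (N.map C).map (algebraMap K[X] (RatFunc K)) = N.map RatFunc.C := by
  ext; simp

/-- The matrix `X I - A` over the rational functions. -/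
noncomputable def ratPencil (A : Matrix n n K) : Matrix n n (RatFunc K) :=
  Matrix.scalar n RatFunc.X - A.map RatFunc.C

theorem ratPencil_eq_map_charmatrix (A : Matrix n n K) :
    ratPencil A = (algebraMap K[X] (RatFunc K)).mapMatrix A.charmatrix := by
  ext a b
  by_cases hab : a = b <;> simp [hab, ratPencil]

theorem det_ratPencil (A : Matrix n n K) :
    (ratPencil A).det = algebraMap K[X] (RatFunc K) A.charpoly := by
  rw [ratPencil_eq_map_charmatrix, ← RingHom.map_det, Matrix.charpoly]

theorem isUnit_det_ratPencil (A : Matrix n n K) : IsUnit (ratPencil A).det := by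
  rw [det_ratPencil, isUnit_iff_ne_zero]
  exact (map_ne_zero_iff _ (RatFunc.algebraMap_injective K)).2 (Matrix.charpoly_monic A).ne_zero

theorem smul_inv_ratPencil (A : Matrix n n K) :
    algebraMap K[X] (RatFunc K) A.charpoly • (ratPencil A)⁻¹
      = (algebraMap K[X] (RatFunc K)).mapMatrix A.charmatrix.adjugate := by
  have h := isUnit_det_ratPencil A
  rw [Matrix.inv_def, smul_smul, ← det_ratPencil, Ring.mul_inverse_cancel _ h, one_smul,
    RingHom.map_adjugate, ratPencil_eq_map_charmatrix]

/-- Read as a polynomial with matrix coefficients, the adjugate times `X - A` is the characteristic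
polynomial times the identity. The factor `X - A` is monic of degree 1, so it raises the degree by
exactly 1. This is the strict properness of `(X I - A)⁻¹`. -/
theorem degree_adjugate_charmatrix_lt (A : Matrix n n K) (i j : n) :
    (A.charmatrix.adjugate i j).degree < A.charpoly.degree := by
  have : Nonempty n := ⟨i⟩
  set M := matPolyEquiv A.charmatrix.adjugate with hM
  have h1 : M * (X - C A) = A.charpoly.map (algebraMap K (Matrix n n K)) := by
    rw [hM, ← Matrix.matPolyEquiv_charmatrix, ← map_mul, Matrix.adjugate_mul,
      ← matPolyEquiv_smul_one, Matrix.charpoly]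
  have h2 : M.degree + 1 ≤ A.charpoly.degree := by
    rw [← degree_X_sub_C A, ← (monic_X_sub_C A).degree_mul, h1]
    exact degree_map_le
  have h3 : (A.charmatrix.adjugate i j).degree ≤ M.degree := by
    refine (degree_le_iff_coeff_zero _ _).2 fun k hk => ?_
    rw [← matPolyEquiv_coeff_apply, ← hM, coeff_eq_zero_of_degree_lt hk]
    rfl
  have h4 : A.charpoly.degree ≠ ⊥ := by
    simp
  refine lt_of_le_of_lt h3 ?_
  by_cases hb : M.degree = ⊥
  · rw [hb]; exact bot_lt_iff_ne_bot.2 h4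
  · refine lt_of_lt_of_le ?_ h2
    obtain ⟨d, hd⟩ := WithBot.ne_bot_iff_exists.1 hb
    rw [← hd]
    exact WithBot.coe_lt_coe.2 (Nat.lt_succ_self d)

/-- A strictly proper rational matrix `C (X I - A)⁻¹ Z` that is polynomial vanishes. -/
theorem mul_inv_ratPencil_mul_eq_zero (A : Matrix n n K) (M : Matrix l n K) (Z : Matrix n q K)
    (P : Matrix l q K[X])
    (h : M.map RatFunc.C * (ratPencil A)⁻¹ * Z.map RatFunc.C = P.map (algebraMap _ (RatFunc K))) :
    M.map RatFunc.C * (ratPencil A)⁻¹ * Z.map RatFunc.C = 0 := by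
  have hinj := RatFunc.algebraMap_injective K
  have h1 : (M.map C * A.charmatrix.adjugate * Z.map C) = A.charpoly • P := by
    have h2 : (M.map C * A.charmatrix.adjugate * Z.map C).map (algebraMap _ (RatFunc K))
        = (A.charpoly • P).map (algebraMap _ (RatFunc K)) := by
      rw [Matrix.map_mul, Matrix.map_mul, map_C_map_algebraMap, map_C_map_algebraMap,
        ← RingHom.mapMatrix_apply, ← smul_inv_ratPencil, Matrix.mul_smul, Matrix.smul_mul, h]
      ext; simp
    ext1 i j
    exact hinj (congrFun (congrFun h2 i) j)
  -- The entries on the left of `h1` have degree below that of the characteristic polynomial, while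
  -- any nonzero multiple of it does not.
  have hP : P = 0 := by
    ext1 i j
    by_contra h0
    have h2 : ((M.map C * A.charmatrix.adjugate * Z.map C) i j).degree < A.charpoly.degree := by
      have hm : ∀ N : Submodule K K[X], N = degreeLT K A.charpoly.natDegree →
          (M.map C * A.charmatrix.adjugate * Z.map C) i j ∈ N := by
        rintro N rfl
        rw [Matrix.mul_apply]
        refine Submodule.sum_mem _ fun b _ => ?_
        rw [Matrix.mul_apply, Finset.sum_mul]
        refine Submodule.sum_mem _ fun a _ => ?_
        rw [mul_comm, Matrix.map_apply, Matrix.map_apply, ← smul_eq_C_mul, ← smul_eq_C_mul]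
        refine Submodule.smul_mem _ _ (Submodule.smul_mem _ _ ?_)
        rw [mem_degreeLT, ← degree_eq_natDegree (Matrix.charpoly_monic A).ne_zero]
        exact degree_adjugate_charmatrix_lt A a b
      have := hm _ rfl
      rwa [mem_degreeLT, ← degree_eq_natDegree (Matrix.charpoly_monic A).ne_zero] at this
    rw [h1, Matrix.smul_apply, smul_eq_mul, degree_mul] at h2
    refine absurd h2 (not_lt.2 ?_)
    exact le_add_of_nonneg_right (zero_le_degree_iff.2 h0)
  rw [h, hP]
  ext; simp

theorem map_mul_inv_ratPencil (A : Matrix n n K) :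
    A.map RatFunc.C * (ratPencil A)⁻¹ = (RatFunc.X : RatFunc K) • (ratPencil A)⁻¹ - 1 := by
  have h := Matrix.mul_nonsing_inv _ (isUnit_det_ratPencil A)
  conv at h => enter [1, 1]; rw [ratPencil]
  rw [Matrix.sub_mul, Matrix.scalar_apply, ← Matrix.smul_eq_diagonal_mul] at h
  rw [← h]; abel

/-- If `M (X I - A)⁻¹ Z = 0` then all the Markov parameters `M Aᵏ Z` vanish. -/
theorem markov_eq_zero (A : Matrix n n K) (Z : Matrix n q K) (k : ℕ) :
    ∀ M : Matrix l n K, M.map RatFunc.C * (ratPencil A)⁻¹ * Z.map RatFunc.C = 0 →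
      M * A ^ k * Z = 0 := by
  -- Since `A (X I - A)⁻¹ = X (X I - A)⁻¹ - 1`, replacing `M` by `M A` leaves the constant `-M Z`.
  -- Being polynomial and strictly proper it vanishes, so `M A` satisfies the same hypothesis as
  -- `M`.
  have key : ∀ M : Matrix l n K, M.map RatFunc.C * (ratPencil A)⁻¹ * Z.map RatFunc.C = 0 →
      (M * A).map RatFunc.C * (ratPencil A)⁻¹ * Z.map RatFunc.C = 0 ∧ M * Z = 0 := by
    intro M h
    have h1 : (M * A).map RatFunc.C * (ratPencil A)⁻¹ * Z.map RatFunc.C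
        = - (M * Z).map RatFunc.C := by
      rw [Matrix.map_mul, Matrix.map_mul, Matrix.mul_assoc (M.map _), map_mul_inv_ratPencil,
        Matrix.mul_sub, Matrix.sub_mul, Matrix.mul_smul, Matrix.smul_mul, h, Matrix.mul_one,
        smul_zero, zero_sub]
    have h2 := mul_inv_ratPencil_mul_eq_zero A (M * A) Z ((-(M * Z)).map C) (by
      rw [map_C_map_algebraMap, h1]; ext; exact (map_neg (RatFunc.C (K := K)) _).symm)
    refine ⟨h2, ?_⟩
    rw [h2] at h1
    ext i j
    have h3 : RatFunc.C ((M * Z) i j) = 0 := neg_eq_zero.1 (congrFun (congrFun h1 i) j).symm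
    simpa using h3
  induction k with
  | zero => intro M h; simpa using (key M h).2
  | succ k ih =>
    intro M h
    rw [pow_succ', ← Matrix.mul_assoc M]
    exact ih _ (key M h).1

/-- `D(X) I - D(A)` is a left multiple of `X I - A`. -/
theorem exists_charmatrix_mul_eq (A : Matrix n n K) (D : K[X]) :
    ∃ Q : Matrix n n K[X], A.charmatrix * Q = Matrix.scalar n D - (aeval A D).map C := by
  induction D using Polynomial.induction_on' with
  | add p r hp hr =>
    obtain ⟨P, hP⟩ := hp
    obtain ⟨R, hR⟩ := hr
    refine ⟨P + R, ?_⟩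
    rw [Matrix.mul_add, hP, hR, map_add, map_add, Matrix.map_add _ (by simp)]
    abel
  | monomial k a =>
    induction k with
    | zero =>
      refine ⟨0, ?_⟩
      ext i j : 2
      by_cases h : i = j <;>
        simp [h, Matrix.algebraMap_matrix_apply]
    | succ k ih =>
      obtain ⟨Q, hQ⟩ := ih
      -- From `X p(X) - A p(A) = X (p(X) - p(A)) + (X - A) p(A)`.
      refine ⟨(X : K[X]) • Q + (aeval A (monomial k a)).map C, ?_⟩
      have e1 : (monomial (k + 1) a : K[X]) = X * monomial k a := by
        rw [Polynomial.X_mul_monomial]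
      have e2 : A.charmatrix = Matrix.scalar n (X : K[X]) - A.map (C : K →+* K[X]) := rfl
      rw [Matrix.mul_add, Matrix.mul_smul, hQ, e1, map_mul (aeval A), aeval_X,
        Matrix.map_mul (f := (C : K →+* K[X])), e2, Matrix.sub_mul, smul_sub,
        map_mul (Matrix.scalar n), Matrix.scalar_apply, Matrix.scalar_apply,
        ← Matrix.smul_eq_diagonal_mul, ← Matrix.smul_eq_diagonal_mul]
      abel

/-- Modulo polynomial matrices, `(X I - A)⁻¹ D(A)` is `D (X I - A)⁻¹`. So if `D` clears the
denominators of the transfer matrix, then `M (X I - A)⁻¹ D(A) Z` is polynomial, hence zero, and its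
Markov parameters vanish. -/
theorem mul_aeval_mul_eq_zero (A : Matrix n n K) (M : Matrix l n K) (Z : Matrix n q K)
    (D : K[X]) (P : Matrix l q K[X])
    (h : algebraMap K[X] (RatFunc K) D • (M.map RatFunc.C * (ratPencil A)⁻¹ * Z.map RatFunc.C)
      = P.map (algebraMap _ (RatFunc K))) (k : ℕ) :
    M * A ^ k * (aeval A D * Z) = 0 := by
  refine markov_eq_zero A _ k M ?_
  obtain ⟨Q, hQ⟩ := exists_charmatrix_mul_eq A D
  have h1 : (ratPencil A)⁻¹ * (aeval A D).map RatFunc.C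
      = algebraMap K[X] (RatFunc K) D • (ratPencil A)⁻¹ - Q.map (algebraMap _ (RatFunc K)) := by
    have h2 : (aeval A D).map C = Matrix.scalar n D - A.charmatrix * Q := by rw [hQ]; abel
    have h3 : (aeval A D).map RatFunc.C = algebraMap K[X] (RatFunc K) D • 1 -
        ratPencil A * Q.map (algebraMap _ (RatFunc K)) := by
      rw [← map_C_map_algebraMap, h2, ratPencil_eq_map_charmatrix, RingHom.mapMatrix_apply,
        ← Matrix.map_mul, Matrix.map_sub _ (by simp)]
      congr 1
      ext i j
      by_cases hij : i = j <;> simp [hij, -algebraMap_smul]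
    rw [h3, Matrix.mul_sub, Matrix.mul_smul, Matrix.mul_one,
      Matrix.nonsing_inv_mul_cancel_left _ _ (isUnit_det_ratPencil A)]
  refine mul_inv_ratPencil_mul_eq_zero A M _ (P - M.map C * Q * Z.map C) ?_
  rw [Matrix.map_mul, ← Matrix.mul_assoc, Matrix.mul_assoc (M.map _), h1, Matrix.mul_sub,
    Matrix.sub_mul, Matrix.mul_smul, Matrix.smul_mul, h,
    ← map_C_map_algebraMap M, ← map_C_map_algebraMap Z, Matrix.map_sub _ (by simp),
    Matrix.map_mul, Matrix.map_mul]

end ResolventAlgebra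

/-! ### Minimal realizations: controllability, observability, no hidden modes. -/

section Minimality

/-- Kalman's condition: the columns of the matrices `Aᵏ B` have trivial orthogonal complement. -/
def IsControllable {n p : ℕ} (A : Matrix (Fin n) (Fin n) ℝ) (B : Matrix (Fin n) (Fin p) ℝ) : Prop :=
  ∀ w : Fin n → ℝ, (∀ k, Matrix.vecMul w (A ^ k * B) = 0) → w = 0

/-- Used with `P` the coordinate matrix of the inclusion of an `A`-invariant subspace containing the
columns of `B`: the system restricted to that subspace has the same transfer matrix. -/
theorem IsRealization.of_intertwining {m p n r : ℕ} {G : Matrix (Fin m) (Fin p) (RatFunc ℝ)}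
    {A : Matrix (Fin n) (Fin n) ℝ} {B : Matrix (Fin n) (Fin p) ℝ} {M : Matrix (Fin m) (Fin n) ℝ}
    (h : IsRealization G A B M) {A' : Matrix (Fin r) (Fin r) ℝ} {B' : Matrix (Fin r) (Fin p) ℝ}
    {P : Matrix (Fin n) (Fin r) ℝ} (hA : P * A' = A * P) (hB : P * B' = B) :
    IsRealization G A' B' (M * P) := by
  have h1 : P.map RatFunc.C * ratPencil A' = ratPencil A * P.map RatFunc.C := by
    simp only [ratPencil, Matrix.mul_sub, Matrix.sub_mul]
    rw [← Matrix.map_mul, ← Matrix.map_mul, hA, Matrix.scalar_apply, Matrix.scalar_apply,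
      ← Matrix.smul_eq_diagonal_mul, ← Matrix.smul_eq_mul_diagonal]
  have h2 : (ratPencil A)⁻¹ * P.map RatFunc.C = P.map RatFunc.C * (ratPencil A')⁻¹ := by
    have h3 := congrArg (fun N => (ratPencil A)⁻¹ * (N * (ratPencil A')⁻¹)) h1
    simpa only [Matrix.mul_nonsing_inv_cancel_right _ _ (isUnit_det_ratPencil A'),
      Matrix.mul_assoc (ratPencil A), Matrix.nonsing_inv_mul_cancel_left _ _
      (isUnit_det_ratPencil A)] using h3
  change G = _ * (ratPencil A')⁻¹ * _
  change G = _ * (ratPencil A)⁻¹ * _ at h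
  rw [h, ← hB, Matrix.map_mul, Matrix.map_mul, Matrix.mul_assoc (M.map _) (P.map _), ← h2]
  simp only [Matrix.mul_assoc]

/-- The span `V` of the columns of all `Aᵏ B` is `A`-invariant, and restricting to it gives a
realization of order `dim V`. Minimality forces `V` to be everything, so nothing nonzero is
orthogonal to it. -/
theorem IsRealization.isControllable {m p n : ℕ} {G : Matrix (Fin m) (Fin p) (RatFunc ℝ)}
    {A : Matrix (Fin n) (Fin n) ℝ} {B : Matrix (Fin n) (Fin p) ℝ} {M : Matrix (Fin m) (Fin n) ℝ}
    (h : IsRealization G A B M) (hn : mcMillanDegree G = n) : IsControllable A B := by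
  intro w hw
  set V : Submodule ℝ (Fin n → ℝ) :=
    Submodule.span ℝ (Set.range fun x : ℕ × Fin p => fun i =>
      (A ^ x.1 * B : Matrix (Fin n) (Fin p) ℝ) i x.2) with hV
  have hgen : ∀ k j, (fun i => (A ^ k * B : Matrix (Fin n) (Fin p) ℝ) i j) ∈ V := fun k j =>
    Submodule.subset_span ⟨(k, j), rfl⟩
  have hinv : ∀ v ∈ V, A.mulVec v ∈ V := by
    intro v hv
    induction hv using Submodule.span_induction with
    | mem x hx =>
      obtain ⟨⟨k, j⟩, rfl⟩ := hx
      convert hgen (k + 1) j using 1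
      rw [pow_succ', Matrix.mul_assoc]
      rfl
    | zero => simp
    | add x y _ _ hx hy => rw [Matrix.mulVec_add]; exact V.add_mem hx hy
    | smul a x _ hx => rw [Matrix.mulVec_smul]; exact V.smul_mem a hx
  let b := Module.finBasis ℝ V
  let P : Matrix (Fin n) (Fin (Module.finrank ℝ V)) ℝ := fun i k => (b k : Fin n → ℝ) i
  have hP : ∀ v (hv : v ∈ V), P.mulVec (b.repr ⟨v, hv⟩) = v := by
    intro v hv
    have := congrArg (Subtype.val) (b.sum_repr ⟨v, hv⟩)
    rw [Submodule.coe_sum] at this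
    refine Eq.trans ?_ this
    ext i
    simp [P, Matrix.mulVec, dotProduct, mul_comm]
  have hr : IsRealization G (fun i j => b.repr ⟨_, hinv _ (b j).2⟩ i : Matrix _ _ ℝ)
      (fun i j => b.repr ⟨_, by simpa using hgen 0 j⟩ i : Matrix _ _ ℝ) (M * P) := by
    refine h.of_intertwining ?_ ?_
    · ext i j
      exact congrFun (hP _ (hinv _ (b j).2)) i
    · ext i j
      exact congrFun (hP (fun i => B i j) (by simpa using hgen 0 j)) i
  have hle : n ≤ Module.finrank ℝ V := hn.ge.trans (Nat.sInf_le ⟨_, _, _, hr⟩)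
  have htop : V = ⊤ := by
    refine Submodule.eq_top_of_finrank_eq (le_antisymm (Submodule.finrank_le V) ?_)
    simpa using hle
  have hort : ∀ v ∈ V, w ⬝ᵥ v = 0 := by
    intro v hv
    induction hv using Submodule.span_induction with
    | mem x hx =>
      obtain ⟨⟨k, j⟩, rfl⟩ := hx
      exact congrFun (hw k) j
    | zero => simp
    | add x y _ _ hx hy => rw [dotProduct_add, hx, hy, add_zero]
    | smul a x _ hx => rw [dotProduct_smul, hx, smul_zero]
  exact dotProduct_self_eq_zero.1 (hort w (htop ▸ Submodule.mem_top))

theorem IsRealization.transpose {m p n : ℕ} {G : Matrix (Fin m) (Fin p) (RatFunc ℝ)}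
    {A : Matrix (Fin n) (Fin n) ℝ} {B : Matrix (Fin n) (Fin p) ℝ} {M : Matrix (Fin m) (Fin n) ℝ}
    (h : IsRealization G A B M) :
    IsRealization G.transpose A.transpose M.transpose B.transpose := by
  unfold IsRealization at h ⊢
  rw [h, Matrix.transpose_mul, Matrix.transpose_mul, Matrix.transpose_nonsing_inv,
    Matrix.transpose_sub, Matrix.transpose_map, Matrix.transpose_map, Matrix.transpose_map,
    Matrix.mul_assoc]
  simp

theorem mcMillanDegree_transpose {m p : ℕ} (G : Matrix (Fin m) (Fin p) (RatFunc ℝ)) :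
    mcMillanDegree G.transpose = mcMillanDegree G := by
  unfold mcMillanDegree
  congr 1
  ext N
  constructor
  · rintro ⟨A, B, M, h⟩
    exact ⟨_, _, _, by simpa using h.transpose⟩
  · rintro ⟨A, B, M, h⟩
    exact ⟨_, _, _, h.transpose⟩

/-- Duality: the transposed realization is a minimal realization of the transposed `G`. -/
theorem IsRealization.isObservable {m p n : ℕ} {G : Matrix (Fin m) (Fin p) (RatFunc ℝ)}
    {A : Matrix (Fin n) (Fin n) ℝ} {B : Matrix (Fin n) (Fin p) ℝ} {M : Matrix (Fin m) (Fin n) ℝ}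
    (h : IsRealization G A B M) (hn : mcMillanDegree G = n) :
    IsControllable A.transpose M.transpose :=
  h.transpose.isControllable (by rw [mcMillanDegree_transpose, hn])

/-- A polynomial clearing the denominators of `G` annihilates the state matrix of a minimal
realization. -/
theorem IsRealization.aeval_eq_zero {m p n : ℕ} {G : Matrix (Fin m) (Fin p) (RatFunc ℝ)}
    {A : Matrix (Fin n) (Fin n) ℝ} {B : Matrix (Fin n) (Fin p) ℝ} {M : Matrix (Fin m) (Fin n) ℝ}
    (h : IsRealization G A B M) (hn : mcMillanDegree G = n) (D : ℝ[X])
    (hD : ∀ i j, ∃ q : ℝ[X], algebraMap ℝ[X] (RatFunc ℝ) D * G i j = algebraMap _ _ q) :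
    aeval A D = 0 := by
  choose q hq using hD
  have h1 : ∀ k, M * A ^ k * (aeval A D * B) = 0 := by
    refine mul_aeval_mul_eq_zero A M B D (fun i j => q i j) ?_
    ext i j
    rw [ratPencil, ← h]
    exact hq i j
  have hcomm : ∀ k, aeval A D * A ^ k = A ^ k * aeval A D := fun k =>
    (Commute.pow_right (by simpa using ((Polynomial.commute_X D).map (aeval A)).symm) k :
      Commute (aeval A D) (A ^ k))
  -- As `D(A)` commutes with `A`, `h1` says that `M Aᵏ` kills `D(A) Aˡ B` for all `k` and `l`.
  -- Observability then cancels the left factor here, and controllability cancels the right one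
  -- below.
  have h2 : ∀ l, aeval A D * (A ^ l * B) = 0 := by
    intro l
    ext i j
    have := h.isObservable hn (fun i => (aeval A D * (A ^ l * B)) i j) fun k => by
      rw [← Matrix.transpose_pow, ← Matrix.transpose_mul, Matrix.vecMul_transpose]
      ext i
      have h3 := congrFun (congrFun (h1 (k + l)) i) j
      rw [pow_add, ← Matrix.mul_assoc M, Matrix.mul_assoc (M * _), ← Matrix.mul_assoc (A ^ l),
        ← hcomm l, Matrix.mul_assoc (aeval A D)] at h3
      exact h3
    exact congrFun this i
  ext i j
  have := h.isControllable hn (aeval A D i) fun k => by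
    ext j
    exact congrFun (congrFun (h2 k) i) j
  exact congrFun this j

/-- The state matrix of a minimal realization of a stable `G` is annihilated by a monic polynomial
with all roots in the open left half-plane. -/
theorem IsRealization.exists_stable_annihilator {m p n : ℕ}
    {G : Matrix (Fin m) (Fin p) (RatFunc ℝ)}
    {A : Matrix (Fin n) (Fin n) ℝ} {B : Matrix (Fin n) (Fin p) ℝ} {M : Matrix (Fin m) (Fin n) ℝ}
    (h : IsRealization G A B M) (hn : mcMillanDegree G = n) (hG : IsStable G) :
    ∃ D : ℝ[X], D.Monic ∧ aeval A D = 0 ∧ ∀ s : ℂ, aeval s D = 0 → s.re < 0 := by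
  -- The product of all denominators clears every entry, and each of its roots is a root of some
  -- denominator.
  refine ⟨∏ x : Fin m × Fin p, (G x.1 x.2).denom,
    monic_prod_of_monic _ _ fun x _ => RatFunc.monic_denom _, h.aeval_eq_zero hn _ fun i j => ?_,
    fun s hs => ?_⟩
  · obtain ⟨c, hc⟩ := Finset.dvd_prod_of_mem (fun x : Fin m × Fin p => (G x.1 x.2).denom)
      (Finset.mem_univ (i, j))
    refine ⟨c * (G i j).num, ?_⟩
    have h1 : algebraMap ℝ[X] (RatFunc ℝ) (G i j).denom ≠ 0 := by
      simpa using RatFunc.denom_ne_zero (G i j)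
    rw [hc, map_mul, map_mul, mul_right_comm, mul_comm _ (G i j)]
    conv_lhs => enter [1, 1]; rw [← RatFunc.num_div_denom (G i j)]
    rw [div_mul_cancel₀ _ h1, mul_comm]
  · rw [map_prod] at hs
    obtain ⟨x, -, hx⟩ := Finset.prod_eq_zero_iff.1 hs
    exact hG x.1 x.2 s hx

end Minimality

/-! ### Exponential decay of `e^{tA}` from an annihilating polynomial. -/

section ExponentialDecay

/-- Variation of constants: `e^{-ct} f` has derivative `e^{-ct} h`, of norm at most `K e^{dt}` with
`d = -α - Re c`. Strictness of `Re c < -α` gives `d > 0`, so integration produces no factor `t` and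
the rate `α` is preserved. -/
theorem exp_decay_of_hasDerivAt {E : Type*} [NormedAddCommGroup E] [NormedSpace ℂ E]
    {f h : ℝ → E} {c : ℂ} {K α : ℝ} (hα : c.re < -α)
    (hf : ∀ t, HasDerivAt f (c • f t + h t) t) (hh : ∀ t, 0 ≤ t → ‖h t‖ ≤ K * Real.exp (-α * t)) :
    ∃ K', ∀ t, 0 ≤ t → ‖f t‖ ≤ K' * Real.exp (-α * t) := by
  set d := -α - c.re with hd
  have hd0 : 0 < d := by rw [hd]; linarith
  have hK : 0 ≤ K := by simpa using (norm_nonneg _).trans (hh 0 le_rfl)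
  have hexp : ∀ t : ℝ, ‖Complex.exp (-c * t)‖ = Real.exp (-c.re * t) := fun t => by
    simp [Complex.norm_exp]
  have hg : ∀ t : ℝ, HasDerivAt (fun t : ℝ => Complex.exp (-c * t) • f t)
      (Complex.exp (-c * t) • h t) t := by
    intro t
    have h1 : HasDerivAt (fun t : ℝ => Complex.exp (-c * t)) (Complex.exp (-c * t) * (-c)) t := by
      have h2 : HasDerivAt (fun z : ℂ => Complex.exp (-c * z)) (Complex.exp (-c * t) * (-c)) t := by
        simpa using ((hasDerivAt_id (t : ℂ)).const_mul (-c)).cexp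
      exact h2.comp_ofReal
    refine (h1.smul (hf t)).congr_deriv ?_
    rw [smul_add, smul_smul, mul_neg, neg_smul]
    abel
  have hB : ∀ t : ℝ, HasDerivAt (fun t : ℝ => ‖f 0‖ + K / d * Real.exp (d * t))
      (K * Real.exp (d * t)) t := by
    intro t
    have := (((hasDerivAt_id t).const_mul d).exp.const_mul (K / d)).const_add ‖f 0‖
    refine this.congr_deriv ?_
    rw [mul_one, ← mul_assoc, mul_right_comm, div_mul_cancel₀ _ hd0.ne']
    rfl
  have hbound : ∀ t : ℝ, 0 ≤ t → ‖Complex.exp (-c * t) • f t‖ ≤ ‖f 0‖ + K / d * Real.exp (d * t) := by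
    intro t ht
    refine image_norm_le_of_norm_deriv_right_le_deriv_boundary' (a := 0) (b := t)
      (fun x _ => (hg x).continuousAt.continuousWithinAt) (fun x _ => (hg x).hasDerivWithinAt) ?_
      (fun x _ => (hB x).continuousAt.continuousWithinAt) (fun x _ => (hB x).hasDerivWithinAt) ?_
      ⟨ht, le_rfl⟩
    · simp; positivity
    · intro x hx
      rw [norm_smul, hexp]
      calc Real.exp (-c.re * x) * ‖h x‖ ≤ Real.exp (-c.re * x) * (K * Real.exp (-α * x)) := by
            gcongr; exact hh x hx.1
        _ = K * Real.exp (d * x) := by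
            rw [mul_left_comm, ← Real.exp_add]; congr 2; rw [hd]; ring
  refine ⟨‖f 0‖ + K / d, fun t ht => ?_⟩
  have h1 := hbound t ht
  rw [norm_smul, hexp] at h1
  have h2 : ‖f t‖ = Real.exp (c.re * t) * (Real.exp (-c.re * t) * ‖f t‖) := by
    rw [← mul_assoc, ← Real.exp_add]; simp
  rw [h2]
  calc _ ≤ Real.exp (c.re * t) * (‖f 0‖ + K / d * Real.exp (d * t)) := by gcongr
    _ = ‖f 0‖ * Real.exp (c.re * t) + K / d * Real.exp (-α * t) := by
      rw [mul_add, mul_left_comm, ← Real.exp_add, mul_comm]; congr 3; rw [hd]; ring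
    _ ≤ ‖f 0‖ * Real.exp (-α * t) + K / d * Real.exp (-α * t) := by
      gcongr
    _ = _ := by ring

/-- A substitute for the Jordan form. The function `f(t) = e^{ta} y` satisfies `f' = c f + e^{ta} (a
- c) y`, and `(a - c) y` is annihilated by one factor fewer; hence the induction from the right end
of the list, with `y` arbitrary. -/
theorem exp_decay_of_prod_eq_zero {R : Type*} [NormedRing R] [NormedAlgebra ℂ R] [CompleteSpace R]
    (a : R) {α : ℝ} (l : List ℂ) : ∀ y : R, (∀ c ∈ l, c.re < -α) →
      (l.map fun c => a - algebraMap ℂ R c).prod * y = 0 →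
      ∃ K, ∀ t : ℝ, 0 ≤ t → ‖NormedSpace.exp (t • a) * y‖ ≤ K * Real.exp (-α * t) := by
  induction l using List.reverseRecOn with
  | nil =>
    intro y _ hy
    simp only [List.map_nil, List.prod_nil, one_mul] at hy
    exact ⟨0, fun t _ => by simp [hy]⟩
  | append_singleton l c ih =>
    intro y hl hy
    rw [List.map_append, List.prod_append, mul_assoc] at hy
    obtain ⟨K, hK⟩ := ih _ (fun b hb => hl b (by simp [hb])) hy
    refine exp_decay_of_hasDerivAt (hl c (by simp)) (fun t => ?_) hK
    have h1 := (hasDerivAt_exp_smul_const (𝕂 := ℝ) a t).mul_const y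
    refine h1.congr_deriv ?_
    rw [List.map_singleton, List.prod_singleton]
    rw [sub_mul, mul_sub, ← mul_assoc, ← Algebra.smul_def, mul_smul_comm]
    abel

theorem Matrix.map_ofReal_exp {n : ℕ} (A : Matrix (Fin n) (Fin n) ℝ) :
    (NormedSpace.exp A).map Complex.ofReal = NormedSpace.exp (A.map Complex.ofReal) := by
  have hcont : Continuous (Complex.ofRealHom.mapMatrix : Matrix (Fin n) (Fin n) ℝ →+* _) :=
    continuous_id.matrix_map Complex.continuous_ofReal
  open scoped Matrix.Norms.Operator in
  exact NormedSpace.map_exp (Complex.ofRealHom.mapMatrix) hcont A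

open scoped Matrix.Norms.Operator in
theorem Matrix.norm_entry_le_linfty_opNorm {n : ℕ} (A : Matrix (Fin n) (Fin n) ℂ) (i j : Fin n) :
    ‖A i j‖ ≤ ‖A‖ := by
  rw [Matrix.linfty_opNorm_def]
  have h1 : ‖A i j‖₊ ≤ ∑ j, ‖A i j‖₊ :=
    Finset.single_le_sum (f := fun j => ‖A i j‖₊) (fun _ _ => zero_le) (Finset.mem_univ j)
  exact_mod_cast h1.trans (Finset.le_sup (f := fun i => ∑ j, ‖A i j‖₊) (Finset.mem_univ i))

theorem Matrix.exp_decay_of_prod_eq_zero {n : ℕ} (A : Matrix (Fin n) (Fin n) ℂ) {α : ℝ} (l : List ℂ)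
    (hl : ∀ c ∈ l, c.re < -α) (h : (l.map fun c => A - algebraMap ℂ _ c).prod = 0) :
    ∃ K, ∀ t : ℝ, 0 ≤ t → ∀ i j, ‖NormedSpace.exp (t • A) i j‖ ≤ K * Real.exp (-α * t) := by
  open scoped Matrix.Norms.Operator in
  obtain ⟨K, hK⟩ := _root_.exp_decay_of_prod_eq_zero A l 1 hl (by rw [h, zero_mul])
  refine ⟨K, fun t ht i j => (Matrix.norm_entry_le_linfty_opNorm _ i j).trans ?_⟩
  have := hK t ht
  rw [mul_one] at this
  exact this

theorem Matrix.hasDerivAt_exp_smul_entry {n : ℕ} (A : Matrix (Fin n) (Fin n) ℝ) (i j : Fin n)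
    (t : ℝ) : HasDerivAt (fun t : ℝ => NormedSpace.exp (t • A) i j)
      ((A * NormedSpace.exp (t • A)) i j) t := by
  open scoped Matrix.Norms.Operator in
  have h1 : HasDerivAt (fun t : ℝ => NormedSpace.exp (t • A)) (A * NormedSpace.exp (t • A)) t :=
    hasDerivAt_exp_smul_const' A t
  exact hasDerivAt_pi.1 (hasDerivAt_pi.1 h1 i) j

/-- Over `ℂ` the polynomial splits into linear factors, and its finitely many roots stay a uniform
distance to the left of the imaginary axis. -/
theorem exists_exp_decay {n : ℕ} (A : Matrix (Fin n) (Fin n) ℝ) (D : ℝ[X]) (hD : D.Monic)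
    (hA : aeval A D = 0) (hs : ∀ s : ℂ, aeval s D = 0 → s.re < 0) :
    ∃ K a : ℝ, 0 < a ∧ ∀ t : ℝ, 0 ≤ t → ∀ i j,
      ‖NormedSpace.exp (t • A) i j‖ ≤ K * Real.exp (-a * t) := by
  have hre : ∀ s : Multiset ℂ, (∀ r ∈ s, r.re < 0) → ∃ a > 0, ∀ r ∈ s, r.re < -a := by
    intro s
    induction s using Multiset.induction with
    | empty => exact fun _ => ⟨1, one_pos, by simp⟩
    | cons r s ih =>
      intro h
      obtain ⟨a, ha, hs⟩ := ih fun x hx => h x (Multiset.mem_cons_of_mem hx)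
      have hr := h r (Multiset.mem_cons_self _ _)
      -- Halving keeps the inequality `r.re < -a` strict for the new root.
      refine ⟨min a (-r.re / 2), lt_min ha (by linarith), fun x hx => ?_⟩
      rcases Multiset.mem_cons.1 hx with rfl | hx
      · linarith [min_le_right a (-x.re / 2)]
      · linarith [min_le_left a (-r.re / 2), hs x hx]
  set Dc : ℂ[X] := D.map (algebraMap ℝ ℂ) with hDc
  have hDcm : Dc.Monic := hD.map _
  have hroots : ∀ r ∈ Dc.roots, r.re < 0 := fun r hr => hs r (by
    have := (mem_roots hDcm.ne_zero).1 hr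
    rwa [IsRoot, hDc, eval_map_algebraMap] at this)
  obtain ⟨a, ha, hra⟩ := hre _ hroots
  let φ : Matrix (Fin n) (Fin n) ℝ →ₐ[ℝ] Matrix (Fin n) (Fin n) ℂ := Complex.ofRealAm.mapMatrix
  have hprod : (Dc.roots.toList.map fun c => φ A - algebraMap ℂ _ c).prod = 0 := by
    have h1 : aeval (φ A) Dc = 0 := by
      rw [hDc, aeval_map_algebraMap, aeval_algHom_apply, hA, map_zero]
    have h2 : Dc = (Dc.roots.toList.map fun c => X - C c).prod := by
      conv_lhs => rw [(IsAlgClosed.splits Dc).eq_prod_roots_of_monic hDcm]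
      rw [← Multiset.prod_coe, ← Multiset.map_coe, Multiset.coe_toList]
    rw [h2, map_list_prod, List.map_map] at h1
    rw [← h1]
    congr 2
    ext1 c
    simp
  obtain ⟨K, hK⟩ := Matrix.exp_decay_of_prod_eq_zero (φ A) (α := a) _
    (fun c hc => hra c (Multiset.mem_toList.1 hc)) hprod
  refine ⟨K, a, ha, fun t ht i j => le_of_eq_of_le ?_ (hK t ht i j)⟩
  have h1 : t • φ A = (t • A).map Complex.ofReal := by
    rw [← map_smul]; rfl
  rw [h1, ← Matrix.map_ofReal_exp]
  simp

end ExponentialDecay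

/-! ### Calculus of exponentially decaying functions. -/

section ExpDecays

/-- A continuous function on the line that decays exponentially at `+∞`. -/
structure ExpDecays {𝕜 : Type*} [RCLike 𝕜] (f : ℝ → 𝕜) : Prop where
  continuous : Continuous f
  bound : ∃ K a : ℝ, 0 < a ∧ ∀ t, 0 ≤ t → ‖f t‖ ≤ K * Real.exp (-a * t)

namespace ExpDecays

variable {𝕜 : Type*} [RCLike 𝕜] {f g : ℝ → 𝕜}

theorem zero : ExpDecays (fun _ => (0 : 𝕜)) :=
  ⟨continuous_const, 0, 1, one_pos, fun t _ => by simp⟩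

theorem mul_bounded (hf : ExpDecays f) (hg : Continuous g) {M : ℝ}
    (hM : ∀ t, 0 ≤ t → ‖g t‖ ≤ M) : ExpDecays (fun t => f t * g t) := by
  obtain ⟨K, a, ha, h⟩ := hf.bound
  refine ⟨hf.continuous.mul hg, K * M, a, ha, fun t ht => ?_⟩
  have hM0 : 0 ≤ M := (norm_nonneg _).trans (hM t ht)
  calc ‖f t * g t‖ = ‖f t‖ * ‖g t‖ := norm_mul _ _
    _ ≤ (K * Real.exp (-a * t)) * M :=
      mul_le_mul (h t ht) (hM t ht) (norm_nonneg _) ((norm_nonneg _).trans (h t ht))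
    _ = _ := by ring

theorem mul_const (hf : ExpDecays f) (c : 𝕜) : ExpDecays (fun t => f t * c) :=
  hf.mul_bounded continuous_const (M := ‖c‖) fun _ _ => le_rfl

theorem const_mul (c : 𝕜) (hf : ExpDecays f) : ExpDecays (fun t => c * f t) := by
  simpa only [mul_comm] using hf.mul_const c

theorem mul (hf : ExpDecays f) (hg : ExpDecays g) : ExpDecays (fun t => f t * g t) := by
  obtain ⟨K, a, ha, h⟩ := hg.bound
  refine hf.mul_bounded hg.continuous (M := K) fun t ht => (h t ht).trans ?_
  have hK : 0 ≤ K := by simpa using (norm_nonneg _).trans (h 0 le_rfl)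
  refine mul_le_of_le_one_right hK (Real.exp_le_one_iff.2 ?_)
  nlinarith

theorem add (hf : ExpDecays f) (hg : ExpDecays g) : ExpDecays (fun t => f t + g t) := by
  obtain ⟨K, a, ha, h⟩ := hf.bound
  obtain ⟨L, b, hb, h'⟩ := hg.bound
  refine ⟨hf.continuous.add hg.continuous, K + L, min a b, lt_min ha hb, fun t ht => ?_⟩
  have hK : 0 ≤ K := by simpa using (norm_nonneg _).trans (h 0 le_rfl)
  have hL : 0 ≤ L := by simpa using (norm_nonneg _).trans (h' 0 le_rfl)
  calc ‖f t + g t‖ ≤ K * Real.exp (-a * t) + L * Real.exp (-b * t) :=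
        (norm_add_le _ _).trans (add_le_add (h t ht) (h' t ht))
    _ ≤ K * Real.exp (-min a b * t) + L * Real.exp (-min a b * t) := by
        gcongr
        · exact min_le_left _ _
        · exact min_le_right _ _
    _ = _ := by ring

theorem sum {ι : Type*} (s : Finset ι) {F : ι → ℝ → 𝕜} (h : ∀ i ∈ s, ExpDecays (F i)) :
    ExpDecays (fun t => ∑ i ∈ s, F i t) := by
  classical
  induction s using Finset.induction_on with
  | empty => simpa using zero
  | insert i s hi ih =>
    simp only [Finset.sum_insert hi]
    exact (h i (by simp)).add (ih fun j hj => h j (by simp [hj]))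

theorem integrableOn (hf : ExpDecays f) : IntegrableOn f (Set.Ioi 0) := by
  obtain ⟨K, a, ha, h⟩ := hf.bound
  refine Integrable.mono' ((integrableOn_exp_mul_Ioi (neg_lt_zero.2 ha) 0).const_mul K)
    hf.continuous.aestronglyMeasurable ?_
  filter_upwards [ae_restrict_mem measurableSet_Ioi] with t ht using h t (le_of_lt ht)

theorem tendsto (hf : ExpDecays f) : Filter.Tendsto f Filter.atTop (nhds 0) := by
  obtain ⟨K, a, ha, h⟩ := hf.bound
  refine squeeze_zero_norm' (Filter.eventually_atTop.2 ⟨0, h⟩) ?_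
  have h1 : Filter.Tendsto (fun t : ℝ => Real.exp (-a * t)) Filter.atTop (nhds 0) :=
    Real.tendsto_exp_atBot.comp (Filter.tendsto_id.const_mul_atTop_of_neg (neg_lt_zero.2 ha))
  simpa using h1.const_mul K

/-- The source of both the Lyapunov equation and the resolvent identity for the Laplace transform.
-/
theorem integral_deriv (hf : ExpDecays f) (hg : ExpDecays g) (h : ∀ t, HasDerivAt f (g t) t) :
    ∫ t in Set.Ioi (0 : ℝ), g t = - f 0 := by
  rw [integral_Ioi_of_hasDerivAt_of_tendsto' (fun t _ => h t) hg.integrableOn hf.tendsto, zero_sub]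

theorem ofReal {f : ℝ → ℝ} (hf : ExpDecays f) : ExpDecays (fun t => (f t : ℂ)) := by
  obtain ⟨K, a, ha, h⟩ := hf.bound
  exact ⟨Complex.continuous_ofReal.comp hf.continuous, K, a, ha, fun t ht => by simpa using h t ht⟩

theorem matrix_mul {l m n : Type*} [Fintype m] {M : ℝ → Matrix l m 𝕜} {N : ℝ → Matrix m n 𝕜}
    (hM : ∀ i j, ExpDecays fun t => M t i j) (hN : ∀ i j, ExpDecays fun t => N t i j) (i : l)
    (j : n) : ExpDecays fun t => (M t * N t) i j := by
  simp only [Matrix.mul_apply]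
  exact sum _ fun k _ => (hM i k).mul (hN k j)

theorem const_matrix_mul {l m n : Type*} [Fintype m] (M : Matrix l m 𝕜) {N : ℝ → Matrix m n 𝕜}
    (hN : ∀ i j, ExpDecays fun t => N t i j) (i : l) (j : n) :
    ExpDecays fun t => (M * N t) i j := by
  simp only [Matrix.mul_apply]
  exact sum _ fun k _ => (hN k j).const_mul _

theorem matrix_mul_const {l m n : Type*} [Fintype m] {M : ℝ → Matrix l m 𝕜} (N : Matrix m n 𝕜)
    (hM : ∀ i j, ExpDecays fun t => M t i j) (i : l) (j : n) :
    ExpDecays fun t => (M t * N) i j := by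
  simp only [Matrix.mul_apply]
  exact sum _ fun k _ => (hM i k).mul_const _

end ExpDecays

end ExpDecays

/-! ### Gramians, the Lyapunov equation and the Laplace transform of `e^{tA}`. -/

section Gramian

/-- The matrix exponential `e^{tA}` decays exponentially. -/
def IsHurwitz {n : ℕ} (A : Matrix (Fin n) (Fin n) ℝ) : Prop :=
  ∀ i j, ExpDecays fun t : ℝ => NormedSpace.exp (t • A) i j

theorem IsHurwitz.of_annihilator {n : ℕ} {A : Matrix (Fin n) (Fin n) ℝ} {D : ℝ[X]} (hD : D.Monic)
    (hA : aeval A D = 0) (hs : ∀ s : ℂ, aeval s D = 0 → s.re < 0) : IsHurwitz A := by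
  obtain ⟨K, a, ha, h⟩ := exists_exp_decay A D hD hA hs
  exact fun i j => ⟨continuous_iff_continuousAt.2 fun t =>
    (A.hasDerivAt_exp_smul_entry i j t).continuousAt, K, a, ha, fun t ht => h t ht i j⟩

variable {n p m : ℕ} {A : Matrix (Fin n) (Fin n) ℝ}

theorem exp_smul_transpose (A : Matrix (Fin n) (Fin n) ℝ) (t : ℝ) :
    NormedSpace.exp (t • A.transpose) = (NormedSpace.exp (t • A)).transpose := by
  rw [← Matrix.transpose_smul, Matrix.exp_transpose]

theorem IsHurwitz.transpose (h : IsHurwitz A) : IsHurwitz A.transpose := fun i j => by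
  simp only [exp_smul_transpose, Matrix.transpose_apply]
  exact h j i

/-- Duality: results on controllability Gramians transfer to observability Gramians. -/
theorem observabilityGramian_eq (A : Matrix (Fin n) (Fin n) ℝ) (M : Matrix (Fin m) (Fin n) ℝ) :
    observabilityGramian A M = controllabilityGramian A.transpose M.transpose := by
  simp [observabilityGramian, controllabilityGramian]

theorem IsHurwitz.gramian_integrand (h : IsHurwitz A) (B : Matrix (Fin n) (Fin p) ℝ) (i j : Fin n) :
    ExpDecays fun t : ℝ =>
      (NormedSpace.exp (t • A) * B * B.transpose * NormedSpace.exp (t • A.transpose)) i j :=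
  ExpDecays.matrix_mul (ExpDecays.matrix_mul_const _ (ExpDecays.matrix_mul_const _ h)) h.transpose
    i j

theorem controllabilityGramian_transpose (A : Matrix (Fin n) (Fin n) ℝ)
    (B : Matrix (Fin n) (Fin p) ℝ) :
    (controllabilityGramian A B).transpose = controllabilityGramian A B := by
  ext i j
  simp only [controllabilityGramian, Matrix.transpose_apply, Matrix.of_apply]
  congr 1 with t
  refine Eq.trans (Matrix.transpose_apply _ i j).symm (congrFun (congrFun ?_ i) j)
  simp only [exp_smul_transpose, Matrix.transpose_mul, Matrix.transpose_transpose,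
    Matrix.mul_assoc]
  rfl

/-- Congruence transforms of the Gramian as integrals of squares. -/
theorem IsHurwitz.congr_gramian_diag {ι : Type*} (h : IsHurwitz A) (B : Matrix (Fin n) (Fin p) ℝ)
    (T : Matrix ι (Fin n) ℝ) (i : ι) :
    (T * controllabilityGramian A B * T.transpose) i i
      = ∫ t in Set.Ioi (0 : ℝ), ∑ j, (T * NormedSpace.exp (t • A) * B) i j ^ 2 := by
  have h1 : ∀ t : ℝ, ∑ j, (T * NormedSpace.exp (t • A) * B) i j ^ 2
      = ∑ b, (∑ a, T i a * (NormedSpace.exp (t • A) * B * B.transpose *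
          NormedSpace.exp (t • A.transpose)) a b) * T i b := by
    intro t
    have h2 : ∑ j, (T * NormedSpace.exp (t • A) * B) i j ^ 2
        = ((T * NormedSpace.exp (t • A) * B) * (T * NormedSpace.exp (t • A) * B).transpose) i i := by
      rw [Matrix.mul_apply]
      exact Finset.sum_congr rfl fun j _ => sq _
    have h3 : (T * NormedSpace.exp (t • A) * B) * (T * NormedSpace.exp (t • A) * B).transpose
        = T * (NormedSpace.exp (t • A) * B * B.transpose *
          NormedSpace.exp (t • A.transpose)) * T.transpose := by
      simp only [exp_smul_transpose, Matrix.transpose_mul, Matrix.mul_assoc]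
    rw [h2, h3, Matrix.mul_apply]
    simp only [Matrix.mul_apply (M := T), Matrix.transpose_apply]
  simp only [h1]
  rw [integral_finsetSum, Matrix.mul_apply]
  · refine Finset.sum_congr rfl fun b _ => ?_
    rw [integral_mul_const, integral_finsetSum, Matrix.mul_apply, Matrix.transpose_apply]
    · congr 1
      refine Finset.sum_congr rfl fun a _ => ?_
      rw [integral_const_mul]
      rfl
    · exact fun a _ => ((h.gramian_integrand B a b).const_mul _).integrableOn
  · exact fun b _ => ((ExpDecays.sum _ fun a _ =>
      (h.gramian_integrand B a b).const_mul _).mul_const _).integrableOn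

/-- The Lyapunov equation. -/
theorem IsHurwitz.lyapunov (h : IsHurwitz A) (B : Matrix (Fin n) (Fin p) ℝ) :
    A * controllabilityGramian A B + controllabilityGramian A B * A.transpose
      = -(B * B.transpose) := by
  set F : ℝ → Matrix (Fin n) (Fin n) ℝ := fun t =>
    NormedSpace.exp (t • A) * B * B.transpose * NormedSpace.exp (t • A.transpose) with hF
  -- The integrand solves `F' = A F + F Aᵀ` with `F(0) = B Bᵀ` and decays to 0; integrating this
  -- over the half-line is the claim.
  have hd : ∀ i j t, HasDerivAt (fun t => F t i j) ((A * F t + F t * A.transpose) i j) t := by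
    intro i j t
    have h1 : ∀ i b, HasDerivAt (fun t : ℝ => (NormedSpace.exp (t • A) * (B * B.transpose)) i b)
        ((A * NormedSpace.exp (t • A) * (B * B.transpose)) i b) t := by
      intro i b
      simp only [Matrix.mul_apply (N := B * B.transpose)]
      exact HasDerivAt.fun_sum fun k _ => (A.hasDerivAt_exp_smul_entry i k t).mul_const _
    have h2 : ∀ b j, HasDerivAt (fun t : ℝ => NormedSpace.exp (t • A.transpose) b j)
        ((NormedSpace.exp (t • A.transpose) * A.transpose) b j) t := by
      intro b j
      simp only [exp_smul_transpose, ← Matrix.transpose_mul]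
      exact A.hasDerivAt_exp_smul_entry j b t
    have h3 : HasDerivAt (fun t => F t i j)
        (∑ b, ((A * NormedSpace.exp (t • A) * (B * B.transpose)) i b *
            NormedSpace.exp (t • A.transpose) b j +
          (NormedSpace.exp (t • A) * (B * B.transpose)) i b *
            (NormedSpace.exp (t • A.transpose) * A.transpose) b j)) t := by
      simp only [hF, Matrix.mul_assoc _ B, Matrix.mul_apply (N := NormedSpace.exp (_ • A.transpose))]
      exact HasDerivAt.fun_sum fun b _ => (h1 i b).fun_mul (h2 b j)
    refine h3.congr_deriv ?_
    rw [Finset.sum_add_distrib, ← Matrix.mul_apply, ← Matrix.mul_apply, Matrix.add_apply]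
    simp only [hF, Matrix.mul_assoc]
  have hFd : ∀ i j, ExpDecays fun t => F t i j := h.gramian_integrand B
  ext i j
  have h1 := (hFd i j).integral_deriv (g := fun t => (A * F t + F t * A.transpose) i j)
    ((ExpDecays.const_matrix_mul A hFd i j).add (ExpDecays.matrix_mul_const A.transpose hFd i j))
    (hd i j)
  have h2 : F 0 = B * B.transpose := by simp [hF]
  rw [h2] at h1
  rw [Matrix.neg_apply, ← h1]
  simp only [Matrix.add_apply, Matrix.mul_apply (M := A), Matrix.mul_apply (N := A.transpose)]
  rw [integral_add, integral_finsetSum, integral_finsetSum]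
  · simp only [integral_const_mul, integral_mul_const]
    rfl
  · exact fun k _ => ((hFd _ _).mul_const _).integrableOn
  · exact fun k _ => ((hFd _ _).const_mul _).integrableOn
  · exact (ExpDecays.sum _ fun k _ => (hFd _ _).const_mul _).integrableOn
  · exact (ExpDecays.sum _ fun k _ => (hFd _ _).mul_const _).integrableOn

/-- The Laplace transform of the matrix exponential. -/
noncomputable def laplaceExp (A : Matrix (Fin n) (Fin n) ℝ) (s : ℂ) : Matrix (Fin n) (Fin n) ℂ :=
  Matrix.of fun i j => ∫ t in Set.Ioi (0 : ℝ),
    Complex.exp (-s * t) * (NormedSpace.exp (t • A) i j : ℂ)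

theorem IsHurwitz.laplace_integrand (h : IsHurwitz A) {s : ℂ} (hs : 0 ≤ s.re) (i j : Fin n) :
    ExpDecays fun t : ℝ => Complex.exp (-s * t) * (NormedSpace.exp (t • A) i j : ℂ) := by
  simp only [mul_comm (Complex.exp _)]
  refine (h i j).ofReal.mul_bounded (by fun_prop) (M := 1) fun t ht => ?_
  rw [Complex.norm_exp, Real.exp_le_one_iff]
  simp
  positivity

/-- The function `F(t) = e^{-st} e^{tA}` satisfies `F' = -(s - A) F` and `F(0) = 1`, and still
decays when `Re s = 0`. So the resolvent exists on the closed right half-plane, imaginary axis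
included. -/
theorem IsHurwitz.sub_mul_laplaceExp (h : IsHurwitz A) {s : ℂ} (hs : 0 ≤ s.re) :
    (Matrix.scalar (Fin n) s - A.map Complex.ofReal) * laplaceExp A s = 1 := by
  set F : ℝ → Matrix (Fin n) (Fin n) ℂ := fun t => Matrix.of fun i j =>
    Complex.exp (-s * t) * (NormedSpace.exp (t • A) i j : ℂ) with hF
  have hFd : ∀ i j, ExpDecays fun t => F t i j := h.laplace_integrand hs
  set M := Matrix.scalar (Fin n) s - A.map Complex.ofReal with hM
  have hd : ∀ i j t, HasDerivAt (fun t => F t i j) (((-M) * F t) i j) t := by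
    intro i j t
    have h1 : HasDerivAt (fun t : ℝ => Complex.exp (-s * t)) (Complex.exp (-s * t) * (-s)) t := by
      have h2 : HasDerivAt (fun z : ℂ => Complex.exp (-s * z)) (Complex.exp (-s * t) * (-s)) t := by
        simpa using ((hasDerivAt_id (t : ℂ)).const_mul (-s)).cexp
      exact h2.comp_ofReal
    refine (h1.mul (A.hasDerivAt_exp_smul_entry i j t).ofReal_comp).congr_deriv ?_
    have h3 : ((-M) * F t) i j = ∑ k, (A i k : ℂ) * F t k j - s * F t i j := by
      rw [hM, neg_sub, Matrix.sub_mul, Matrix.sub_apply, Matrix.scalar_apply,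
        Matrix.diagonal_mul, Matrix.mul_apply]
      rfl
    rw [h3, Matrix.mul_apply]
    simp only [hF, Matrix.of_apply, Complex.ofReal_sum, Complex.ofReal_mul, Finset.mul_sum]
    rw [add_comm, sub_eq_add_neg]
    congr 1
    · exact Finset.sum_congr rfl fun k _ => by ring
    · ring
  ext i j
  have h1 := (hFd i j).integral_deriv (ExpDecays.const_matrix_mul (-M) hFd i j) (hd i j)
  have h2 : F 0 = 1 := by
    ext i j
    by_cases hij : i = j <;> simp [hF, hij, Matrix.one_apply]
  rw [h2] at h1
  simp only [Matrix.mul_apply (M := -M)] at h1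
  rw [integral_finsetSum _ fun k _ => ((hFd _ _).const_mul _).integrableOn] at h1
  simp only [integral_const_mul] at h1
  simp only [Matrix.neg_apply, neg_mul, Finset.sum_neg_distrib, neg_inj] at h1
  rw [← h1, Matrix.mul_apply]
  rfl

end Gramian

/-! ### Positive definite Gramians and balancing. -/

section Balancing

variable {n p m : ℕ}

theorem IsHurwitz.gramian_quadratic {A : Matrix (Fin n) (Fin n) ℝ} (h : IsHurwitz A)
    (B : Matrix (Fin n) (Fin p) ℝ) (x : Fin n → ℝ) :
    x ⬝ᵥ (controllabilityGramian A B).mulVec x = ∫ t in Set.Ioi (0 : ℝ),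
      ∑ j, (Matrix.vecMul x (NormedSpace.exp (t • A) * B)) j ^ 2 := by
  have h1 := h.congr_gramian_diag B (Matrix.replicateRow Unit x) ()
  rw [Matrix.transpose_replicateRow, Matrix.mul_assoc] at h1
  refine Eq.trans ?_ (h1.trans ?_)
  · rfl
  · simp only [Matrix.mul_assoc]
    rfl

theorem IsHurwitz.gramian_posSemidef {A : Matrix (Fin n) (Fin n) ℝ} (h : IsHurwitz A)
    (B : Matrix (Fin n) (Fin p) ℝ) : (controllabilityGramian A B).PosSemidef := by
  refine Matrix.PosSemidef.of_dotProduct_mulVec_nonneg ?_ fun x => ?_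
  · rw [Matrix.IsHermitian, Matrix.conjTranspose_eq_transpose_of_trivial,
      controllabilityGramian_transpose]
  · rw [star_trivial, h.gramian_quadratic]
    exact integral_nonneg fun t => Finset.sum_nonneg fun j _ => sq_nonneg _

/-- The controllability Gramian of a controllable pair is positive definite: by the Lyapunov
equation its kernel is invariant under `Aᵀ` and contained in the kernel of `Bᵀ`. -/
theorem IsHurwitz.gramian_posDef {A : Matrix (Fin n) (Fin n) ℝ} (h : IsHurwitz A)
    {B : Matrix (Fin n) (Fin p) ℝ} (hB : IsControllable A B) :
    (controllabilityGramian A B).PosDef := by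
  have hs := h.gramian_posSemidef B
  set W := controllabilityGramian A B with hW
  have hly : ∀ x : Fin n → ℝ, A.mulVec (W.mulVec x) + W.mulVec (A.transpose.mulVec x)
      = - B.mulVec (B.transpose.mulVec x) := by
    intro x
    have := congrArg (fun M => Matrix.mulVec M x) (h.lyapunov B)
    simpa only [Matrix.add_mulVec, Matrix.neg_mulVec, ← Matrix.mulVec_mulVec] using this
  -- Pairing the Lyapunov equation with `x` kills its left side when `W x = 0` and leaves `‖Bᵀ x‖² =
  -- 0`.
  have hker : ∀ x, W.mulVec x = 0 → B.transpose.mulVec x = 0 := by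
    intro x hx
    have h1 := congrArg (fun v => x ⬝ᵥ v) (hly x)
    simp only [hx, Matrix.mulVec_zero, zero_add, dotProduct_neg] at h1
    rw [Matrix.dotProduct_mulVec, ← Matrix.mulVec_transpose, controllabilityGramian_transpose, ← hW,
      hx, zero_dotProduct, Matrix.dotProduct_mulVec, ← Matrix.mulVec_transpose, eq_comm,
      neg_eq_zero] at h1
    exact dotProduct_self_eq_zero.1 h1
  have hinv : ∀ (k : ℕ) x, W.mulVec x = 0 → W.mulVec ((A.transpose ^ k).mulVec x) = 0 := by
    intro k
    induction k with
    | zero => intro x hx; simpa using hx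
    | succ k ih =>
      intro x hx
      rw [pow_succ, ← Matrix.mulVec_mulVec]
      refine ih _ ?_
      simpa [hx, hker x hx] using hly x
  refine Matrix.PosDef.of_dotProduct_mulVec_pos hs.isHermitian fun x hx => ?_
  refine lt_of_le_of_ne (hs.dotProduct_mulVec_nonneg x) fun h0 => hx ?_
  have hx0 := (hs.dotProduct_mulVec_zero_iff x).1 h0.symm
  refine hB x fun k => ?_
  rw [← Matrix.mulVec_transpose, Matrix.transpose_mul, Matrix.transpose_pow,
    ← Matrix.mulVec_mulVec]
  exact hker _ (hinv k x hx0)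

open scoped MatrixOrder in
theorem Matrix.PosSemidef.exists_eq_transpose_mul_self {W : Matrix (Fin n) (Fin n) ℝ}
    (h : W.PosSemidef) : ∃ L : Matrix (Fin n) (Fin n) ℝ, W = L.transpose * L := by
  obtain ⟨L, hL⟩ := CStarAlgebra.nonneg_iff_eq_star_mul_self.mp h.nonneg
  exact ⟨L, by rw [hL, Matrix.star_eq_conjTranspose, Matrix.conjTranspose_eq_transpose_of_trivial]⟩

/-- Simultaneous diagonalization by contragredient congruence: a balancing transformation. -/
theorem exists_balancing {W V : Matrix (Fin n) (Fin n) ℝ} (hW : W.PosDef) (hV : V.PosDef) :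
    ∃ T S : Matrix (Fin n) (Fin n) ℝ, T * S = 1 ∧
      ∑ i, (S * W * S.transpose) i i = ((W * V).charpoly.roots.map Real.sqrt).sum ∧
      ∑ i, (T.transpose * V * T) i i = ((W * V).charpoly.roots.map Real.sqrt).sum := by
  obtain ⟨L, hL⟩ := hW.posSemidef.exists_eq_transpose_mul_self
  have hLdet : IsUnit L.det := by
    have := (Matrix.isUnit_iff_isUnit_det _).1 hW.isUnit
    rw [hL, Matrix.det_mul] at this
    exact isUnit_of_mul_isUnit_right this
  have hLdet' : IsUnit L.transpose.det := by rwa [Matrix.det_transpose]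
  have hM : (L * V * L.transpose).PosDef := by
    have h1 := hV.conjTranspose_mul_mul_same (B := L.transpose)
      (Matrix.mulVec_injective_iff_isUnit.2 ((Matrix.isUnit_iff_isUnit_det _).2 hLdet'))
    simpa [Matrix.conjTranspose_eq_transpose_of_trivial] using h1
  set lam := hM.isHermitian.eigenvalues with hlam
  have hpos : ∀ i, 0 < lam i := hM.eigenvalues_pos
  -- With `W = Lᵀ L`, the matrices `Lᵀ (L V)` and `(L V) Lᵀ` have the same characteristic
  -- polynomial, so the eigenvalues of `W V` are those of a symmetric matrix.
  have hroots : ((W * V).charpoly.roots.map Real.sqrt).sum = ∑ i, Real.sqrt (lam i) := by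
    rw [hL, Matrix.mul_assoc, Matrix.charpoly_mul_comm, hM.isHermitian.roots_charpoly_eq_eigenvalues,
      Multiset.map_map]
    rfl
  set U : Matrix (Fin n) (Fin n) ℝ :=
    (hM.isHermitian.eigenvectorUnitary : Matrix (Fin n) (Fin n) ℝ) with hU
  have hUU : U.transpose * U = 1 := by
    have := Unitary.coe_star_mul_self hM.isHermitian.eigenvectorUnitary
    rwa [← hU, Matrix.star_eq_conjTranspose, Matrix.conjTranspose_eq_transpose_of_trivial] at this
  have hUU' : U * U.transpose = 1 := mul_eq_one_comm.1 hUU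
  have hdiag : U.transpose * (L * V * L.transpose) * U = Matrix.diagonal lam := by
    have := hM.isHermitian.conjStarAlgAut_star_eigenvectorUnitary
    rw [Unitary.conjStarAlgAut_star_apply, ← hU] at this
    simpa [Matrix.star_eq_conjTranspose, Matrix.conjTranspose_eq_transpose_of_trivial,
      Function.comp_def] using this
  -- Fourth roots: `S W Sᵀ = q²` and `Tᵀ V T = q⁻¹ lam q⁻¹` then both equal `√lam`.
  set q : Fin n → ℝ := fun i => Real.sqrt (Real.sqrt (lam i)) with hq
  have hq0 : ∀ i, q i ≠ 0 := fun i => (Real.sqrt_pos.2 (Real.sqrt_pos.2 (hpos i))).ne'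
  have hqq : ∀ i, q i * q i = Real.sqrt (lam i) := fun i => Real.mul_self_sqrt (Real.sqrt_nonneg _)
  have hq4 : ∀ i, q i * q i * (q i * q i) = lam i := fun i => by
    rw [hqq, Real.mul_self_sqrt (hpos i).le]
  refine ⟨L.transpose * U * Matrix.diagonal q⁻¹, Matrix.diagonal q * U.transpose * L.transpose⁻¹,
    ?_, ?_, ?_⟩
  · calc _ = L.transpose * (U * (Matrix.diagonal q⁻¹ * Matrix.diagonal q) * U.transpose)
          * L.transpose⁻¹ := by simp only [Matrix.mul_assoc]
      _ = 1 := by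
        have : Matrix.diagonal q⁻¹ * Matrix.diagonal q = (1 : Matrix (Fin n) (Fin n) ℝ) := by
          rw [Matrix.diagonal_mul_diagonal, ← Matrix.diagonal_one]
          congr 1
          ext i
          exact inv_mul_cancel₀ (hq0 i)
        rw [this, Matrix.mul_one, hUU', Matrix.mul_one, Matrix.mul_nonsing_inv _ hLdet']
  · have h1 : Matrix.diagonal q * U.transpose * L.transpose⁻¹ * W *
        (Matrix.diagonal q * U.transpose * L.transpose⁻¹).transpose
        = Matrix.diagonal fun i => q i * q i := by
      calc _ = Matrix.diagonal q * (U.transpose * ((L.transpose⁻¹ * L.transpose) *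
            (L * L⁻¹)) * U) * Matrix.diagonal q := by
            rw [hL]
            simp only [Matrix.transpose_mul, Matrix.transpose_nonsing_inv,
              Matrix.transpose_transpose, Matrix.diagonal_transpose, Matrix.mul_assoc]
        _ = _ := by
            rw [Matrix.nonsing_inv_mul _ hLdet', Matrix.mul_nonsing_inv _ hLdet, Matrix.mul_one,
              Matrix.mul_one, hUU, Matrix.mul_one, Matrix.diagonal_mul_diagonal]
    rw [h1, hroots]
    exact Finset.sum_congr rfl fun i _ => by rw [Matrix.diagonal_apply_eq, hqq]
  · have h1 : (L.transpose * U * Matrix.diagonal q⁻¹).transpose * V *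
        (L.transpose * U * Matrix.diagonal q⁻¹) = Matrix.diagonal fun i => q i * q i := by
      calc _ = Matrix.diagonal q⁻¹ * (U.transpose * (L * V * L.transpose) * U) *
            Matrix.diagonal q⁻¹ := by
            simp only [Matrix.transpose_mul, Matrix.transpose_transpose, Matrix.diagonal_transpose,
              Matrix.mul_assoc]
        _ = _ := by
            rw [hdiag, Matrix.diagonal_mul_diagonal, Matrix.diagonal_mul_diagonal]
            congr 1
            ext i
            rw [← hq4 i, Pi.inv_apply]
            have := hq0 i
            field_simp
    rw [h1, hroots]
    exact Finset.sum_congr rfl fun i _ => by rw [Matrix.diagonal_apply_eq, hqq]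

end Balancing

/-! ### The peak gain against the Hankel singular values. -/

section PeakGain

/-- Young's inequality for convolutions with an `L^∞` input: if every row sum of `|g t|` is bounded
by an integrable function then its integral bounds the peak gain. -/
theorem peakGain_le_of_row_sum_le {m p : ℕ} {g : ℝ → Matrix (Fin m) (Fin p) ℝ} {ψ : ℝ → ℝ}
    (hψ : Continuous ψ) (hψ0 : ∀ t, 0 ≤ t → 0 ≤ ψ t) (hψi : IntegrableOn ψ (Set.Ioi 0))
    (hg : ∀ t, 0 ≤ t → ∀ i, ∑ j, |g t i j| ≤ ψ t) :
    peakGain g ≤ ENNReal.ofReal (∫ t in Set.Ioi (0 : ℝ), ψ t) := by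
  refine iSup_le fun u => iSup_le fun hu => iSup_le fun hu0 => ?_
  refine ENNReal.div_le_of_le_mul ?_
  set U := (peakNorm u).toReal with hU
  have hfin : peakNorm u ≠ ⊤ := hu.2.ne
  have hUe : peakNorm u = ENNReal.ofReal U := (ENNReal.ofReal_toReal hfin).symm
  have hae : ∀ᵐ s ∂(volume.restrict (Set.Ici (0 : ℝ))), ‖u s‖ ≤ U := by
    filter_upwards [ae_le_eLpNormEssSup (f := u) (μ := volume.restrict (Set.Ici (0 : ℝ)))] with s hs
    rw [← eLpNorm_exponent_top] at hs
    rw [← toReal_enorm]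
    exact ENNReal.toReal_mono hfin hs
  rw [ae_restrict_iff' measurableSet_Ici] at hae
  have hI0 : 0 ≤ ∫ t in Set.Ioi (0 : ℝ), ψ t :=
    setIntegral_nonneg measurableSet_Ioi fun t ht => hψ0 t (le_of_lt ht)
  have hU0 : 0 ≤ U := ENNReal.toReal_nonneg
  rw [hUe, ← ENNReal.ofReal_mul hI0, peakNorm, eLpNorm_exponent_top]
  refine eLpNormEssSup_le_of_ae_bound ?_
  filter_upwards [ae_restrict_mem measurableSet_Ici] with t ht
  have ht : 0 ≤ t := ht
  refine (pi_norm_le_iff_of_nonneg (mul_nonneg hI0 hU0)).2 fun i => ?_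
  have h1 : ‖response g u t i‖ ≤ ∫ s in (0 : ℝ)..t, ψ (t - s) * U := by
    refine intervalIntegral.norm_integral_le_of_norm_le ht ?_
      (Continuous.intervalIntegrable (by fun_prop) _ _)
    filter_upwards [hae] with s hs hst
    have hts : 0 ≤ t - s := sub_nonneg.2 hst.2
    calc ‖(g (t - s)).mulVec (u s) i‖ ≤ ∑ j, ‖g (t - s) i j * u s j‖ :=
          norm_sum_le Finset.univ fun j => g (t - s) i j * u s j
      _ ≤ ∑ j, |g (t - s) i j| * U := by
          refine Finset.sum_le_sum fun j _ => ?_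
          rw [norm_mul, Real.norm_eq_abs]
          gcongr
          exact (norm_le_pi_norm _ j).trans (hs hst.1.le)
      _ ≤ ψ (t - s) * U := by
          rw [← Finset.sum_mul]
          exact mul_le_mul_of_nonneg_right (hg _ hts i) hU0
  refine h1.trans ?_
  rw [intervalIntegral.integral_mul_const, intervalIntegral.integral_comp_sub_left, sub_self,
    sub_zero, intervalIntegral.integral_of_le ht]
  refine mul_le_mul_of_nonneg_right (setIntegral_mono_set hψi ?_ ?_) hU0
  · filter_upwards [ae_restrict_mem measurableSet_Ioi] with s hs using hψ0 s (le_of_lt hs)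
  · exact Filter.Eventually.of_forall fun s hs => hs.1

/-- AM-GM in the form `|a b| ≤ (√p / 2) b² + a² / (2 √p)`. Summing over the `p` columns counts each
`a²` exactly `p` times, and this weight makes both coefficients `√p / 2`. -/
theorem Matrix.row_sum_mul_le {m n p : ℕ} (M : Matrix (Fin m) (Fin n) ℝ)
    (N : Matrix (Fin n) (Fin p) ℝ) (i : Fin m) :
    ∑ j, |(M * N) i j| ≤ Real.sqrt p / 2 * (∑ k, ∑ j, N k j ^ 2 + ∑ k, M i k ^ 2) := by
  rcases Nat.eq_zero_or_pos p with rfl | hp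
  · simp
  have hp' : 0 < Real.sqrt p := Real.sqrt_pos.2 (by exact_mod_cast hp)
  have hpp : (p : ℝ) = Real.sqrt p * Real.sqrt p := (Real.mul_self_sqrt (by positivity)).symm
  calc ∑ j, |(M * N) i j|
      ≤ ∑ j, ∑ k, (Real.sqrt p / 2 * N k j ^ 2 + M i k ^ 2 / (2 * Real.sqrt p)) := by
        refine Finset.sum_le_sum fun j _ => ?_
        rw [Matrix.mul_apply]
        refine (Finset.abs_sum_le_sum_abs _ _).trans (Finset.sum_le_sum fun k _ => ?_)
        rw [abs_mul, ← sq_abs (N k j), ← sq_abs (M i k), ← sub_nonneg]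
        have : Real.sqrt p / 2 * |N k j| ^ 2 + |M i k| ^ 2 / (2 * Real.sqrt p) - |M i k| * |N k j|
            = (Real.sqrt p * |N k j| - |M i k|) ^ 2 / (2 * Real.sqrt p) := by
          field_simp
          ring
        rw [this]
        positivity
    _ = Real.sqrt p / 2 * (∑ k, ∑ j, N k j ^ 2 + ∑ k, M i k ^ 2) := by
        simp only [Finset.sum_add_distrib, ← Finset.mul_sum, ← Finset.sum_div]
        rw [Finset.sum_const, Finset.card_univ, Fintype.card_fin, nsmul_eq_mul, mul_add,
          Finset.sum_comm]
        congr 1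
        field_simp
        rw [sq, ← hpp, mul_comm]

/-- The integral of a squared Frobenius norm is the trace of the congruence-transformed Gramian. -/
theorem IsHurwitz.sum_congr_gramian_diag {n p : ℕ} {ι : Type*} [Fintype ι]
    {A : Matrix (Fin n) (Fin n) ℝ} (h : IsHurwitz A)
    (B : Matrix (Fin n) (Fin p) ℝ) (T : Matrix ι (Fin n) ℝ) :
    ExpDecays (fun t : ℝ => ∑ k, ∑ j, (T * NormedSpace.exp (t • A) * B) k j ^ 2) ∧
    ∫ t in Set.Ioi (0 : ℝ), ∑ k, ∑ j, (T * NormedSpace.exp (t • A) * B) k j ^ 2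
      = ∑ k, (T * controllabilityGramian A B * T.transpose) k k := by
  have hd : ∀ k, ExpDecays fun t : ℝ => ∑ j, (T * NormedSpace.exp (t • A) * B) k j ^ 2 := by
    intro k
    refine ExpDecays.sum _ fun j _ => ?_
    have := ExpDecays.matrix_mul_const B (ExpDecays.const_matrix_mul T h) k j
    simpa only [sq] using this.mul this
  refine ⟨ExpDecays.sum _ fun k _ => hd k, ?_⟩
  rw [integral_finsetSum _ fun k _ => (hd k).integrableOn]
  exact Finset.sum_congr rfl fun k _ => (h.congr_gramian_diag B T k).symm

theorem IsHurwitz.peakGain_le {m p n : ℕ} {A : Matrix (Fin n) (Fin n) ℝ} (hA : IsHurwitz A)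
    {B : Matrix (Fin n) (Fin p) ℝ} {M : Matrix (Fin m) (Fin n) ℝ} (hB : IsControllable A B)
    (hM : IsControllable A.transpose M.transpose) :
    peakGain (impulseResponse A B M)
      ≤ ENNReal.ofReal (2 * Real.sqrt p * (hankelSingularValues A B M).sum) := by
  have hV : (observabilityGramian A M).PosDef := by
    rw [observabilityGramian_eq]
    exact hA.transpose.gramian_posDef hM
  obtain ⟨T, S, hTS, h1, h2⟩ := exists_balancing (hA.gramian_posDef hB) hV
  change _ = (hankelSingularValues A B M).sum at h1 h2
  obtain ⟨hb, hbi⟩ := hA.sum_congr_gramian_diag B S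
  obtain ⟨hc, hci⟩ := hA.transpose.sum_congr_gramian_diag M.transpose T.transpose
  rw [h1] at hbi
  rw [← observabilityGramian_eq, Matrix.transpose_transpose, h2] at hci
  set b : ℝ → ℝ := fun t => ∑ k, ∑ j, (S * NormedSpace.exp (t • A) * B) k j ^ 2 with hbdef
  set c : ℝ → ℝ := fun t =>
    ∑ k, ∑ i, (T.transpose * NormedSpace.exp (t • A.transpose) * M.transpose) k i ^ 2 with hcdef
  -- Write `e^{tA}` as `e^{tA/2} T S e^{tA/2}` and apply the product bound to the two halves.
  have hrow : ∀ t, ∀ i, ∑ j, |impulseResponse A B M t i j|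
      ≤ Real.sqrt p / 2 * (b (t * 2⁻¹) + c (t * 2⁻¹)) := by
    intro t i
    have hg : impulseResponse A B M t = (M * NormedSpace.exp ((t * 2⁻¹) • A) * T) *
        (S * NormedSpace.exp ((t * 2⁻¹) • A) * B) := by
      have he : NormedSpace.exp (t • A)
          = NormedSpace.exp ((t * 2⁻¹) • A) * NormedSpace.exp ((t * 2⁻¹) • A) := by
        rw [← Matrix.exp_add_of_commute _ _ (Commute.refl _), ← add_smul]
        congr 2
        ring
      rw [impulseResponse, he]
      calc _ = M * NormedSpace.exp ((t * 2⁻¹) • A) * (1 : Matrix (Fin n) (Fin n) ℝ) *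
            (NormedSpace.exp ((t * 2⁻¹) • A) * B) := by
            rw [Matrix.mul_one]; simp only [Matrix.mul_assoc]
        _ = _ := by rw [← hTS]; simp only [Matrix.mul_assoc]
    rw [hg]
    refine (Matrix.row_sum_mul_le _ _ i).trans ?_
    gcongr
    rw [hcdef]
    refine Finset.sum_le_sum fun k _ => ?_
    have h3 : ∀ i', (T.transpose * NormedSpace.exp ((t * 2⁻¹) • A.transpose) * M.transpose) k i'
        = (M * NormedSpace.exp ((t * 2⁻¹) • A) * T) i' k := by
      intro i'
      rw [← Matrix.transpose_apply (M * _ * T), exp_smul_transpose, Matrix.transpose_mul,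
        Matrix.transpose_mul, Matrix.mul_assoc]
    simp only [h3]
    -- The squares of row `i` are bounded by those of all rows, giving a bound independent of `i`.
    exact Finset.single_le_sum (f := fun i' => (M * NormedSpace.exp ((t * 2⁻¹) • A) * T) i' k ^ 2)
      (fun _ _ => sq_nonneg _) (Finset.mem_univ i)
  have hbc := hb.add hc
  refine (peakGain_le_of_row_sum_le (ψ := fun t => Real.sqrt p / 2 * (b (t * 2⁻¹) + c (t * 2⁻¹)))
    ?_ ?_ ?_ fun t _ => hrow t).trans (ENNReal.ofReal_le_ofReal (le_of_eq ?_))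
  · exact (hbc.continuous.comp (continuous_mul_const _)).const_mul _
  · intro t _
    simp only [hbdef, hcdef]
    positivity
  · refine Integrable.const_mul ?_ _
    have := (integrableOn_Ioi_comp_mul_right_iff (fun t => b t + c t) 0
      (inv_pos.2 (two_pos (α := ℝ)))).2 (by rw [zero_mul]; exact hbc.integrableOn)
    exact this
  -- The half-time substitution contributes a factor 2, for a total of `(√p / 2) · 2 · (Σσ + Σσ)`.
  · rw [integral_const_mul, integral_comp_mul_right_Ioi (fun t => b t + c t) 0
      (inv_pos.2 (two_pos (α := ℝ))), zero_mul, integral_add hb.integrableOn hc.integrableOn,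
      hbi, hci, inv_inv, smul_eq_mul]
    ring

end PeakGain

/-! ### Plancherel for integrable, square-integrable functions. -/

section Plancherel

open FourierTransform SchwartzMap

theorem integral_schwartz_smul_fourier_eq {F : Type*} [NormedAddCommGroup F] [NormedSpace ℂ F]
    [CompleteSpace F] {f : ℝ → F} (hf : Integrable f) (g : 𝓢(ℝ, ℂ)) :
    ∫ x, 𝓕 g x • f x = ∫ x, g x • 𝓕 f x := by
  rw [SchwartzMap.fourier_coe]
  simpa using! VectorFourier.integral_fourierIntegral_smul_eq_flip (L := innerₗ ℝ)
    Real.continuous_fourierChar continuous_inner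
    (g.integrable (μ := volume)) hf

theorem continuous_fourier_of_integrable {F : Type*} [NormedAddCommGroup F] [NormedSpace ℂ F]
    {f : ℝ → F} (hf : Integrable f) : Continuous (𝓕 f) :=
  VectorFourier.fourierIntegral_continuous Real.continuous_fourierChar (L := innerₗ ℝ)
    continuous_inner hf

theorem fourier_add_apply {F : Type*} [NormedAddCommGroup F] [NormedSpace ℂ F] {f g : ℝ → F}
    (hf : Integrable f) (hg : Integrable g) (w : ℝ) :
    𝓕 (fun t => f t + g t) w = 𝓕 f w + 𝓕 g w :=
  congrFun (VectorFourier.fourierIntegral_add Real.continuous_fourierChar (L := innerₗ ℝ)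
    continuous_inner hf hg).symm w |>.symm

/-- Plancherel's theorem for the Fourier integral of a function in `L¹ ∩ L²`. -/
theorem eLpNorm_fourier_eq {F : Type*} [NormedAddCommGroup F] [InnerProductSpace ℂ F]
    [CompleteSpace F] {f : ℝ → F} (h1 : Integrable f) (h2 : MemLp f 2) :
    eLpNorm (𝓕 f) 2 = eLpNorm f 2 := by
  set fL : Lp F 2 (volume : Measure ℝ) := h2.toLp f with hfL
  set Ff : Lp F 2 (volume : Measure ℝ) := 𝓕 fL with hFf
  -- `Ff` is the `L²` transform, `𝓕 f` the integral. Both are tested against Schwartz functions by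
  -- moving the transform onto the test function; agreement almost everywhere follows, and the `L²`
  -- isometry then applies to `𝓕 f`.
  have hS : ∀ g : 𝓢(ℝ, ℂ), ∫ x, g x • Ff x = ∫ x, g x • 𝓕 f x := by
    intro g
    have e1 : (Lp.toTemperedDistribution Ff) g = (Lp.toTemperedDistribution fL) (𝓕 g) := by
      rw [hFf, ← Lp.fourier_toTemperedDistribution_eq]
      rfl
    rw [Lp.toTemperedDistribution_apply, Lp.toTemperedDistribution_apply] at e1
    rw [e1, ← integral_schwartz_smul_fourier_eq h1]
    refine integral_congr_ae ?_
    filter_upwards [h2.coeFn_toLp] with x hx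
    rw [hx]
  have hcont : Continuous (𝓕 f) := continuous_fourier_of_integrable h1
  have hae : ∀ᵐ x, Ff x = 𝓕 f x := by
    refine ae_eq_of_integral_contDiff_smul_eq
      ((Lp.memLp Ff).locallyIntegrable (by norm_num)) hcont.locallyIntegrable fun g hg hgs => ?_
    have hgc : HasCompactSupport (Complex.ofRealCLM ∘ g) := hgs.comp_left rfl
    have hgd : ContDiff ℝ (⊤ : ℕ∞) (Complex.ofRealCLM ∘ g) := by fun_prop
    calc ∫ x, g x • Ff x = ∫ x, hgc.toSchwartzMap hgd x • Ff x := by simp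
      _ = ∫ x, hgc.toSchwartzMap hgd x • 𝓕 f x := hS _
      _ = ∫ x, g x • 𝓕 f x := by simp
  rw [← eLpNorm_congr_ae hae]
  have h3 : ‖Ff‖ = ‖fL‖ := Lp.norm_fourier_eq fL
  rw [Lp.norm_def, Lp.norm_def, ENNReal.toReal_eq_toReal_iff' (Lp.memLp _).2.ne (Lp.memLp _).2.ne]
    at h3
  rw [h3, hfL, eLpNorm_congr_ae h2.coeFn_toLp]

theorem fourier_comp_neg {F : Type*} [NormedAddCommGroup F] [NormedSpace ℂ F] (f : ℝ → F) (w : ℝ) :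
    𝓕 (fun t => f (-t)) w = 𝓕 f (-w) := by
  rw [Real.fourier_real_eq_integral_exp_smul, Real.fourier_real_eq_integral_exp_smul,
    ← integral_neg_eq_self]
  simp

end Plancherel

/-! ### Decaying signals on the half-line and their Fourier transforms. -/

section HalfLineSignals

open FourierTransform

variable {ι : Type*}

/-- A real vector signal on `t > 0`, extended by zero, as a complex Euclidean vector signal. -/
noncomputable def halfLine (v : ℝ → ι → ℝ) : ℝ → EuclideanSpace ℂ ι :=
  (Set.Ioi (0 : ℝ)).indicator fun t => WithLp.toLp 2 fun i => (v t i : ℂ)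

variable {v : ℝ → ι → ℝ}

theorem norm_toLp_ofReal_sq [Fintype ι] (x : ι → ℝ) :
    ‖(WithLp.toLp 2 fun i => (x i : ℂ) : EuclideanSpace ℂ ι)‖ ^ 2 = ∑ i, x i ^ 2 := by
  rw [EuclideanSpace.norm_sq_eq]
  simp

theorem continuous_toLp_ofReal (hv : ∀ i, ExpDecays fun t => v t i) :
    Continuous fun t => (WithLp.toLp 2 fun i => (v t i : ℂ) : EuclideanSpace ℂ ι) :=
  (PiLp.continuous_toLp 2 _).comp (continuous_pi fun i => (hv i).ofReal.continuous)

variable [Fintype ι]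

theorem integrable_halfLine (hv : ∀ i, ExpDecays fun t => v t i) : Integrable (halfLine v) := by
  rw [halfLine, integrable_indicator_iff measurableSet_Ioi]
  refine Integrable.mono' (integrable_finsetSum Finset.univ fun i _ =>
    (hv i).ofReal.integrableOn.norm) (continuous_toLp_ofReal hv).aestronglyMeasurable ?_
  refine Filter.Eventually.of_forall fun t => ?_
  refine (Real.le_sqrt_of_sq_le (norm_toLp_ofReal_sq _).le).trans ?_
  refine Real.sqrt_le_iff.2 ⟨Finset.sum_nonneg fun i _ => norm_nonneg _, ?_⟩
  simp only [Complex.norm_real, Real.norm_eq_abs]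
  simpa using Finset.sum_sq_le_sq_sum_of_nonneg (s := Finset.univ) (f := fun i => |v t i|)
    fun i _ => abs_nonneg _

theorem expDecays_sum_sq (hv : ∀ i, ExpDecays fun t => v t i) :
    ExpDecays fun t => ∑ i, v t i ^ 2 :=
  ExpDecays.sum _ fun i _ => by simpa only [sq] using (hv i).mul (hv i)

theorem memLp_halfLine (hv : ∀ i, ExpDecays fun t => v t i) : MemLp (halfLine v) 2 := by
  rw [halfLine, memLp_indicator_iff_restrict measurableSet_Ioi,
    memLp_two_iff_integrable_sq_norm (continuous_toLp_ofReal hv).aestronglyMeasurable]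
  simp only [norm_toLp_ofReal_sq]
  exact (expDecays_sum_sq hv).integrableOn

theorem toReal_eLpNorm_two_sq {α F : Type*} [MeasurableSpace α] {μ : Measure α}
    [NormedAddCommGroup F] {f : α → F} (hf : MemLp f 2 μ) :
    (eLpNorm f 2 μ).toReal ^ 2 = ∫ x, ‖f x‖ ^ 2 ∂μ := by
  have h0 : 0 ≤ ∫ x, ‖f x‖ ^ (2 : ℝ) ∂μ := integral_nonneg fun x => by positivity
  rw [hf.eLpNorm_eq_integral_rpow_norm (by norm_num) (by norm_num)]
  simp only [ENNReal.toReal_ofNat]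
  rw [ENNReal.toReal_ofReal (by positivity), ← Real.rpow_natCast, ← Real.rpow_mul h0]
  norm_num

theorem toReal_eLpNorm_halfLine_sq (hv : ∀ i, ExpDecays fun t => v t i) :
    (eLpNorm (halfLine v) 2).toReal ^ 2 = ∫ t in Set.Ioi (0 : ℝ), ∑ i, v t i ^ 2 := by
  have h := memLp_halfLine hv
  rw [halfLine, memLp_indicator_iff_restrict measurableSet_Ioi] at h
  rw [halfLine, eLpNorm_indicator_eq_eLpNorm_restrict measurableSet_Ioi, toReal_eLpNorm_two_sq h]
  simp only [norm_toLp_ofReal_sq]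

/-- With the normalization `e^{-2πitw}`, the Fourier transform at `w` is the Laplace transform at `s
= 2πiw`. -/
theorem fourier_halfLine_apply (hv : ∀ i, ExpDecays fun t => v t i) (w : ℝ) (i : ι) :
    𝓕 (halfLine v) w i = ∫ t in Set.Ioi (0 : ℝ),
      Complex.exp (-((2 * Real.pi * w : ℝ) * Complex.I) * t) * (v t i : ℂ) := by
  rw [Real.fourier_real_eq_integral_exp_smul]
  have hint : Integrable ((fun t : ℝ => Complex.exp (↑(-2 * Real.pi * t * w) * Complex.I)) •
      halfLine v) := by
    refine (integrable_halfLine hv).smul_of_top_right (memLp_top_of_bound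
      (Continuous.aestronglyMeasurable (by fun_prop)) 1 ?_)
    exact Filter.Eventually.of_forall fun t => (Complex.norm_exp_ofReal_mul_I _).le
  refine ((EuclideanSpace.proj i : EuclideanSpace ℂ ι →L[ℂ] ℂ).integral_comp_comm hint).symm.trans
    ?_
  rw [← integral_indicator measurableSet_Ioi]
  congr 1 with t
  by_cases ht : t ∈ Set.Ioi (0 : ℝ)
  · simp only [halfLine, Pi.smul_apply', Set.indicator_of_mem ht, map_smul, PiLp.proj_apply,
      smul_eq_mul]
    congr 2
    push_cast
    ring
  · simp [halfLine, Set.indicator_of_notMem ht]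

end HalfLineSignals

/-! ### The transfer function and the Lyapunov equation on the imaginary axis. -/

section FrequencyDomain

variable {m p n : ℕ}

theorem laplaceExp_transpose (A : Matrix (Fin n) (Fin n) ℝ) (s : ℂ) :
    laplaceExp A.transpose s = (laplaceExp A s).transpose := by
  ext i j
  simp [laplaceExp, exp_smul_transpose]

/-- The transfer function on the closed right half-plane, in terms of the Laplace transform. -/
theorem IsHurwitz.evalAt_eq {A : Matrix (Fin n) (Fin n) ℝ} (hA : IsHurwitz A)
    {B : Matrix (Fin n) (Fin p) ℝ} {M : Matrix (Fin m) (Fin n) ℝ}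
    {G : Matrix (Fin m) (Fin p) (RatFunc ℝ)} (hG : IsRealization G A B M) {s : ℂ} (hs : 0 ≤ s.re) :
    evalAt G s = M.map Complex.ofReal * laplaceExp A s * B.map Complex.ofReal := by
  let ev : ℝ[X] →+* ℂ := eval₂RingHom (algebraMap ℝ ℂ) s
  have hchar : ev.mapMatrix A.charmatrix = Matrix.scalar (Fin n) s - A.map Complex.ofReal := by
    ext i j
    by_cases hij : i = j <;> simp [hij, ev]
  have hdet : ev A.charpoly ≠ 0 := by
    have h1 := congrArg Matrix.det (hA.sub_mul_laplaceExp hs)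
    rw [Matrix.det_mul, Matrix.det_one, ← hchar, ← RingHom.map_det, ← Matrix.charpoly] at h1
    exact left_ne_zero_of_mul_eq_one h1
  have hadj : ev.mapMatrix A.charmatrix.adjugate = ev A.charpoly • laplaceExp A s := by
    have h1 := congrArg ev.mapMatrix (Matrix.adjugate_mul A.charmatrix)
    rw [map_mul, hchar] at h1
    have h2 := congrArg (· * laplaceExp A s) h1
    simp only [Matrix.mul_assoc, hA.sub_mul_laplaceExp hs, Matrix.mul_one] at h2
    rw [h2, ← Matrix.charpoly]
    have h3 : ev.mapMatrix (A.charpoly • (1 : Matrix (Fin n) (Fin n) ℝ[X]))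
        = ev A.charpoly • (1 : Matrix (Fin n) (Fin n) ℂ) := by
      ext i j
      by_cases hij : i = j <;> simp [hij]
    rw [h3, Matrix.smul_mul, Matrix.one_mul]
  set N : Matrix (Fin m) (Fin p) ℝ[X] := M.map C * A.charmatrix.adjugate * B.map C with hN
  have hGN : ∀ i j, algebraMap ℝ[X] (RatFunc ℝ) A.charpoly * G i j
      = algebraMap ℝ[X] (RatFunc ℝ) (N i j) := by
    intro i j
    have h1 : algebraMap ℝ[X] (RatFunc ℝ) A.charpoly • G = N.map (algebraMap _ (RatFunc ℝ)) := by
      have hG' : G = M.map RatFunc.C * (ratPencil A)⁻¹ * B.map RatFunc.C := hG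
      rw [hG', hN, Matrix.map_mul, Matrix.map_mul, map_C_map_algebraMap, map_C_map_algebraMap,
        ← RingHom.mapMatrix_apply, ← smul_inv_ratPencil, Matrix.mul_smul, Matrix.smul_mul]
    exact congrFun (congrFun h1 i) j
  have hNev : N.map ev = ev A.charpoly •
      (M.map Complex.ofReal * laplaceExp A s * B.map Complex.ofReal) := by
    have e : ∀ {a b : ℕ} (Z : Matrix (Fin a) (Fin b) ℝ), (Z.map C).map ev
        = Z.map Complex.ofReal := fun Z => by ext; simp [ev]
    rw [hN, Matrix.map_mul, Matrix.map_mul, e, e, ← RingHom.mapMatrix_apply, hadj,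
      Matrix.mul_smul, Matrix.smul_mul]
  ext i j
  have h1 := congrFun (congrFun hNev i) j
  rw [Matrix.map_apply, Matrix.smul_apply, smul_eq_mul] at h1
  have h2 := hGN i j
  rw [← mul_right_inj' hdet, ← h1]
  have h3 : A.charpoly * (G i j).num = N i j * (G i j).denom := by
    apply RatFunc.algebraMap_injective ℝ
    rw [map_mul, map_mul, ← h2, mul_assoc]
    congr 1
    have h0 : algebraMap ℝ[X] (RatFunc ℝ) (G i j).denom ≠ 0 := by
      simpa using RatFunc.denom_ne_zero (G i j)
    conv_rhs => enter [1]; rw [← RatFunc.num_div_denom (G i j)]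
    rw [div_mul_cancel₀ _ h0]
  have h5 : ev (G i j).denom ≠ 0 := by
    -- `RatFunc.eval` divides the values of the reduced numerator and denominator, so the
    -- denominator must not vanish at `s`. By coprimality it divides the characteristic polynomial,
    -- which is nonzero there.
    intro h0
    obtain ⟨c, hc⟩ : (G i j).denom ∣ A.charpoly := by
      refine (RatFunc.isCoprime_num_denom (G i j)).symm.dvd_of_dvd_mul_right ?_
      exact ⟨N i j, by rw [h3, mul_comm]⟩
    rw [hc, map_mul, h0, zero_mul] at hdet
    exact hdet rfl
  have h4 := congrArg ev h3
  rw [map_mul, map_mul] at h4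
  change ev A.charpoly * (ev (G i j).num / ev (G i j).denom) = _
  rw [← mul_div_assoc, h4, mul_div_cancel_right₀ _ h5]

/-- The Lyapunov equation in the frequency domain. -/
theorem IsHurwitz.gramian_mul_laplaceExp {A : Matrix (Fin n) (Fin n) ℝ} (hA : IsHurwitz A)
    (B : Matrix (Fin n) (Fin p) ℝ) {s : ℂ} (hs : s.re = 0) :
    (controllabilityGramian A B).map Complex.ofReal * laplaceExp A.transpose s +
        laplaceExp A (-s) * (controllabilityGramian A B).map Complex.ofReal
      = laplaceExp A (-s) * (B.map Complex.ofReal * (B.map Complex.ofReal).transpose) *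
          laplaceExp A.transpose s := by
  set W : Matrix (Fin n) (Fin n) ℂ := (controllabilityGramian A B).map Complex.ofReal with hW
  -- On the imaginary axis both `s` and `-s` lie in the closed right half-plane, so both resolvents
  -- are available.
  have h1 := hA.sub_mul_laplaceExp (s := -s) (by simp [hs])
  have h2 := hA.transpose.sub_mul_laplaceExp (s := s) hs.ge
  have h1' := mul_eq_one_comm.1 h1
  have hly : A.map Complex.ofReal * W + W * A.transpose.map Complex.ofReal
      = -(B.map Complex.ofReal * (B.map Complex.ofReal).transpose) := by
    have := congrArg (fun Z => Z.map Complex.ofReal) (hA.lyapunov B)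
    have e : ∀ {a b c : ℕ} (Y : Matrix (Fin a) (Fin b) ℝ) (Z : Matrix (Fin b) (Fin c) ℝ),
        (Y * Z).map Complex.ofReal = Y.map Complex.ofReal * Z.map Complex.ofReal := fun Y Z =>
      Matrix.map_mul (f := Complex.ofRealHom)
    rw [Matrix.map_add _ (by simp), e, e, ← hW] at this
    rw [this, ← Matrix.transpose_map, ← e]
    ext
    simp [-Matrix.map_mul]
  have h3 : B.map Complex.ofReal * (B.map Complex.ofReal).transpose
      = (Matrix.scalar (Fin n) (-s) - A.map Complex.ofReal) * W +
        W * (Matrix.scalar (Fin n) s - A.transpose.map Complex.ofReal) := by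
    rw [← neg_neg (B.map _ * _), ← hly, Matrix.sub_mul, Matrix.mul_sub, Matrix.scalar_apply,
      Matrix.scalar_apply, ← Matrix.smul_eq_diagonal_mul, ← Matrix.smul_eq_mul_diagonal, neg_smul]
    abel
  rw [h3, Matrix.mul_add, ← Matrix.mul_assoc, h1', Matrix.one_mul, Matrix.add_mul,
    Matrix.mul_assoc, Matrix.mul_assoc, h2, Matrix.mul_one]

end FrequencyDomain

/-! ### Hankel singular values against the H-infinity norm. -/

section HankelBound

open FourierTransform

variable {m p n : ℕ}

/-- The signal `t ↦ xᵀ e^{tA} N`. -/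
noncomputable def expSignal (A : Matrix (Fin n) (Fin n) ℝ) (N : Matrix (Fin n) (Fin p) ℝ)
    (x : Fin n → ℝ) (t : ℝ) : Fin p → ℝ :=
  Matrix.vecMul x (NormedSpace.exp (t • A) * N)

theorem IsHurwitz.expDecays_expSignal {A : Matrix (Fin n) (Fin n) ℝ} (hA : IsHurwitz A)
    (N : Matrix (Fin n) (Fin p) ℝ) (x : Fin n → ℝ) (i : Fin p) :
    ExpDecays fun t => expSignal A N x t i := by
  simp only [expSignal, Matrix.vecMul, dotProduct]
  exact ExpDecays.sum _ fun k _ => (ExpDecays.matrix_mul_const N hA k i).const_mul _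

theorem IsHurwitz.fourier_halfLine_expSignal {A : Matrix (Fin n) (Fin n) ℝ} (hA : IsHurwitz A)
    (N : Matrix (Fin n) (Fin p) ℝ) (x : Fin n → ℝ) (w : ℝ) :
    𝓕 (halfLine (expSignal A N x)) w = WithLp.toLp 2 (Matrix.vecMul (fun i => (x i : ℂ))
      (laplaceExp A ((2 * Real.pi * w : ℝ) * Complex.I) * N.map Complex.ofReal)) := by
  ext i
  have hs : 0 ≤ (((2 * Real.pi * w : ℝ) : ℂ) * Complex.I).re := by simp
  rw [fourier_halfLine_apply (hA.expDecays_expSignal N x)]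
  have h1 : ∀ t : ℝ, Complex.exp (-((2 * Real.pi * w : ℝ) * Complex.I) * t) *
      (expSignal A N x t i : ℂ) = ∑ k, (x k : ℂ) * ∑ l,
        (Complex.exp (-((2 * Real.pi * w : ℝ) * Complex.I) * t) *
          (NormedSpace.exp (t • A) k l : ℂ)) * (N l i : ℂ) := by
    intro t
    simp only [expSignal, Matrix.vecMul, dotProduct, Matrix.mul_apply, Complex.ofReal_sum,
      Complex.ofReal_mul, Finset.mul_sum]
    refine Finset.sum_congr rfl fun k _ => Finset.sum_congr rfl fun l _ => by ring
  simp only [h1]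
  have hd := hA.laplace_integrand hs
  rw [integral_finsetSum _ fun k _ => ((ExpDecays.sum _ fun l _ =>
    (hd k l).mul_const _).const_mul _).integrableOn]
  refine Finset.sum_congr rfl fun k _ => ?_
  rw [integral_const_mul, integral_finsetSum _ fun l _ => ((hd k l).mul_const _).integrableOn]
  simp only [integral_mul_const]
  rfl

/-- The Hankel operator is bounded by the `H^∞` norm: the energy of the free output from the state
reached by the input `t ↦ Bᵀ e^{-tAᵀ} x`, `t < 0`, against the energy of that input. -/
theorem IsHurwitz.hankel_energy_le {A : Matrix (Fin n) (Fin n) ℝ} (hA : IsHurwitz A)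
    {B : Matrix (Fin n) (Fin p) ℝ} {M : Matrix (Fin m) (Fin n) ℝ}
    {G : Matrix (Fin m) (Fin p) (RatFunc ℝ)} (hG : IsRealization G A B M) (hfin : hInfNorm G ≠ ⊤)
    (x : Fin n → ℝ) :
    (controllabilityGramian A B).mulVec x ⬝ᵥ
        (observabilityGramian A M).mulVec ((controllabilityGramian A B).mulVec x)
      ≤ (hInfNorm G).toReal ^ 2 * (x ⬝ᵥ (controllabilityGramian A B).mulVec x) := by
  set W := controllabilityGramian A B with hW
  set γ := (hInfNorm G).toReal with hγ
  -- The input is `u(-t)`, supported on `t < 0`. For `t > 0` the output is `M e^{tA} W x`, which is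
  -- `y₁`. At time `-τ < 0` the state is `W e^{τAᵀ} x`, whose output is `y₂ τ`. So `y` below is the
  -- response on the whole line.
  set u := halfLine (expSignal A B x) with hu
  set y₁ := halfLine (expSignal A.transpose M.transpose (W.mulVec x)) with hy₁
  set y₂ := halfLine (expSignal A (W * M.transpose) x) with hy₂
  have du := hA.expDecays_expSignal B x
  have d₁ := hA.transpose.expDecays_expSignal M.transpose (W.mulVec x)
  have d₂ := hA.expDecays_expSignal (W * M.transpose) x
  set y : ℝ → EuclideanSpace ℂ (Fin m) := fun t => y₁ t + y₂ (-t) with hy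
  have hyi : Integrable y := (integrable_halfLine d₁).add (integrable_halfLine d₂).comp_neg
  have hneg2 : MemLp (fun t => y₂ (-t)) 2 :=
    (memLp_halfLine d₂).comp_measurePreserving (Measure.measurePreserving_neg _)
  have hym : MemLp y 2 := (memLp_halfLine d₁).add hneg2
  -- No convolution is computed: the frequency-domain Lyapunov equation merges the transforms of the
  -- two pieces into `G(iω)` times that of the input. The sign in `𝓕 u (-w)` is the time reversal.
  have hFy : ∀ w, 𝓕 y w = Matrix.toEuclideanLin (evalAt G ((2 * Real.pi * w : ℝ) * Complex.I))
      (𝓕 u (-w)) := by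
    intro w
    have h1 : 𝓕 y w = 𝓕 y₁ w + 𝓕 y₂ (-w) := by
      rw [← fourier_comp_neg]
      exact fourier_add_apply (integrable_halfLine d₁) (integrable_halfLine d₂).comp_neg w
    rw [h1, hy₁, hy₂, hu, hA.transpose.fourier_halfLine_expSignal, hA.fourier_halfLine_expSignal,
      hA.fourier_halfLine_expSignal]
    set s : ℂ := (2 * Real.pi * w : ℝ) * Complex.I with hs
    have hs0 : s.re = 0 := by simp [hs]
    have hneg : ((2 * Real.pi * -w : ℝ) : ℂ) * Complex.I = -s := by
      rw [hs]; push_cast; ring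
    rw [hneg, hA.evalAt_eq hG hs0.ge]
    have e : ∀ {a b c : ℕ} (Y : Matrix (Fin a) (Fin b) ℝ) (Z : Matrix (Fin b) (Fin c) ℝ),
        (Y * Z).map Complex.ofReal = Y.map Complex.ofReal * Z.map Complex.ofReal := fun Y Z =>
      Matrix.map_mul (f := Complex.ofRealHom)
    have hx : (fun i => ((W.mulVec x) i : ℂ)) = Matrix.vecMul (fun i => (x i : ℂ))
        (W.map Complex.ofReal) := by
      ext i
      have hWs : W.transpose = W := controllabilityGramian_transpose A B
      rw [← Matrix.vecMul_transpose, hWs]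
      simp [Matrix.vecMul, dotProduct]
    rw [hx, Matrix.vecMul_vecMul, ← WithLp.toLp_add, ← Matrix.vecMul_add, e, ← Matrix.mul_assoc,
      ← Matrix.mul_assoc, ← Matrix.add_mul, hA.gramian_mul_laplaceExp B hs0, laplaceExp_transpose,
      Matrix.toLpLin_toLp, Matrix.toLin'_apply, ← Matrix.vecMul_transpose, Matrix.vecMul_vecMul]
    simp only [Matrix.transpose_mul, Matrix.transpose_map, Matrix.mul_assoc]
  have hbound : ∀ w, ‖𝓕 y w‖ ≤ γ * ‖𝓕 u (-w)‖ := by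
    intro w
    rw [hFy w]
    refine (ContinuousLinearMap.le_opNorm (LinearMap.toContinuousLinearMap
      (Matrix.toEuclideanLin (evalAt G ((2 * Real.pi * w : ℝ) * Complex.I)))) _).trans ?_
    gcongr
    rw [hγ, ← ENNReal.ofReal_le_iff_le_toReal hfin]
    exact le_iSup (fun ω : ℝ => ENNReal.ofReal ‖LinearMap.toContinuousLinearMap
      (Matrix.toEuclideanLin (evalAt G (ω * Complex.I)))‖) (2 * Real.pi * w)
  have hPu := eLpNorm_fourier_eq (integrable_halfLine du) (memLp_halfLine du)
  have hPy := eLpNorm_fourier_eq hyi hym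
  -- The two pieces of `y` have disjoint supports, so dropping the past output can only lower the
  -- norm.
  have hle₁ : eLpNorm y₁ 2 ≤ eLpNorm y 2 := by
    refine eLpNorm_mono fun t => ?_
    by_cases ht : 0 < t
    · have h0 : y₂ (-t) = 0 := Set.indicator_of_notMem (by simpa using ht.le) _
      simp [hy, h0]
    · have h0 : y₁ t = 0 := Set.indicator_of_notMem (by simpa using ht) _
      simp [h0]
  have hle₂ := eLpNorm_le_mul_eLpNorm_of_ae_le_mul (μ := volume)
    (Filter.Eventually.of_forall hbound) 2
  have hrefl : eLpNorm (fun w => 𝓕 u (-w)) 2 = eLpNorm (𝓕 u) 2 :=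
    eLpNorm_comp_measurePreserving
      (continuous_fourier_of_integrable (integrable_halfLine du)).aestronglyMeasurable
      (Measure.measurePreserving_neg (volume : Measure ℝ))
  rw [hPy, hrefl, hPu] at hle₂
  have hle := hle₁.trans hle₂
  have hfinu : eLpNorm u 2 ≠ ⊤ := (memLp_halfLine du).2.ne
  have hre : (eLpNorm y₁ 2).toReal ≤ γ * (eLpNorm u 2).toReal := by
    have := ENNReal.toReal_mono (ENNReal.mul_ne_top ENNReal.ofReal_ne_top hfinu) hle
    rwa [ENNReal.toReal_mul, ENNReal.toReal_ofReal ENNReal.toReal_nonneg] at this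
  have hsq := pow_le_pow_left₀ ENNReal.toReal_nonneg hre 2
  rw [mul_pow, hy₁, hu, toReal_eLpNorm_halfLine_sq d₁, toReal_eLpNorm_halfLine_sq du] at hsq
  rw [observabilityGramian_eq, hA.transpose.gramian_quadratic, hW, hA.gramian_quadratic]
  exact hsq

/-- For `W V v = μ v`, the energy inequality at `x = V v` reads `μ² q ≤ ‖G‖_∞² μ q` with `q = vᵀ V
v`. Observability gives `q > 0`, so `μ ≤ ‖G‖_∞²` when `μ > 0`. -/
theorem IsHurwitz.ofReal_hankelSingularValue_le {A : Matrix (Fin n) (Fin n) ℝ} (hA : IsHurwitz A)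
    {B : Matrix (Fin n) (Fin p) ℝ} {M : Matrix (Fin m) (Fin n) ℝ}
    {G : Matrix (Fin m) (Fin p) (RatFunc ℝ)} (hG : IsRealization G A B M)
    (hM : IsControllable A.transpose M.transpose) {σ : ℝ} (hσ : σ ∈ hankelSingularValues A B M) :
    ENNReal.ofReal σ ≤ hInfNorm G := by
  by_cases hfin : hInfNorm G = ⊤
  · simp [hfin]
  have hV : (observabilityGramian A M).PosDef := by
    rw [observabilityGramian_eq]
    exact hA.transpose.gramian_posDef hM
  obtain ⟨μ, hμ, rfl⟩ := Multiset.mem_map.1 hσ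
  set W := controllabilityGramian A B with hW
  set V := observabilityGramian A M with hVdef
  have hroot : (Matrix.scalar (Fin n) μ - W * V).det = 0 := by
    rw [← Matrix.eval_charpoly]
    exact (mem_roots'.1 hμ).2
  obtain ⟨v, hv0, hv⟩ := Matrix.exists_mulVec_eq_zero_iff.2 hroot
  have hev : W.mulVec (V.mulVec v) = μ • v := by
    rw [Matrix.sub_mulVec, sub_eq_zero, ← Matrix.mulVec_mulVec] at hv
    rw [← hv]
    ext i
    simp [Matrix.scalar_apply, Matrix.mulVec_diagonal]
  have hpos : 0 < v ⬝ᵥ V.mulVec v := by simpa using hV.dotProduct_mulVec_pos hv0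
  have h := hA.hankel_energy_le hG hfin (V.mulVec v)
  rw [← hW, ← hVdef, hev, Matrix.mulVec_smul, smul_dotProduct, dotProduct_smul, dotProduct_smul,
    dotProduct_comm (V.mulVec v) v, smul_eq_mul, smul_eq_mul] at h
  rw [ENNReal.ofReal_le_iff_le_toReal hfin]
  rcases le_or_gt μ 0 with hμ0 | hμ0
  · rw [Real.sqrt_eq_zero_of_nonpos hμ0]
    exact ENNReal.toReal_nonneg
  · refine Real.sqrt_le_iff.2 ⟨ENNReal.toReal_nonneg, ?_⟩
    have h2 : 0 < μ * (v ⬝ᵥ V.mulVec v) := mul_pos hμ0 hpos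
    nlinarith

theorem card_hankelSingularValues_le (A : Matrix (Fin n) (Fin n) ℝ) (B : Matrix (Fin n) (Fin p) ℝ)
    (M : Matrix (Fin m) (Fin n) ℝ) : Multiset.card (hankelSingularValues A B M) ≤ n := by
  rw [hankelSingularValues, Multiset.card_map]
  refine (card_roots' _).trans ?_
  rw [Matrix.charpoly_natDegree_eq_dim, Fintype.card_fin]

theorem ENNReal.ofReal_multiset_sum_le (S : Multiset ℝ) {h : ℝ≥0∞}
    (hS : ∀ σ ∈ S, ENNReal.ofReal σ ≤ h) : ENNReal.ofReal S.sum ≤ Multiset.card S * h := by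
  induction S using Multiset.induction with
  | empty => simp
  | cons a S ih =>
    rw [Multiset.sum_cons, Multiset.card_cons, Nat.cast_succ, add_mul, one_mul, add_comm]
    exact ENNReal.ofReal_add_le.trans (add_le_add (ih fun σ hσ => hS σ (Multiset.mem_cons_of_mem hσ))
      (hS a (Multiset.mem_cons_self a S)))

end HankelBound

/-! ### Assembly of the two bounds. -/

theorem lemma4p1 {m p n : ℕ} (G : Matrix (Fin m) (Fin p) (RatFunc ℝ))
    (hproper : IsStrictlyProper G) (hstable : IsStable G) (hn : mcMillanDegree G = n)
    (A : Matrix (Fin n) (Fin n) ℝ) (B : Matrix (Fin n) (Fin p) ℝ) (C : Matrix (Fin m) (Fin n) ℝ)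
    (hreal : IsRealization G A B C) :
    peakGain (impulseResponse A B C)
        ≤ ENNReal.ofReal (2 * Real.sqrt p * (hankelSingularValues A B C).sum) ∧
      peakGain (impulseResponse A B C)
        ≤ ENNReal.ofReal (2 * n * Real.sqrt p) * hInfNorm G := by
  obtain ⟨D, hD, hDA, hDs⟩ := hreal.exists_stable_annihilator hn hstable
  have hA : IsHurwitz A := IsHurwitz.of_annihilator hD hDA hDs
  have hC := hreal.isObservable hn
  have h1 := hA.peakGain_le (hreal.isControllable hn) hC
  refine ⟨h1, h1.trans ?_⟩
  have h2 := ENNReal.ofReal_multiset_sum_le (hankelSingularValues A B C) fun σ hσ =>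
    hA.ofReal_hankelSingularValue_le hreal hC hσ
  calc ENNReal.ofReal (2 * Real.sqrt p * (hankelSingularValues A B C).sum)
      = ENNReal.ofReal (2 * Real.sqrt p) * ENNReal.ofReal (hankelSingularValues A B C).sum :=
        ENNReal.ofReal_mul (by positivity)
    _ ≤ ENNReal.ofReal (2 * Real.sqrt p) * (n * hInfNorm G) := by
        gcongr
        refine h2.trans ?_
        gcongr
        exact card_hankelSingularValues_le A B C
    _ = ENNReal.ofReal (2 * n * Real.sqrt p) * hInfNorm G := by
        rw [← mul_assoc, ← ENNReal.ofReal_natCast n, ← ENNReal.ofReal_mul (by positivity)]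
        congr 2
        ring
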